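/- Let $M$ be a smooth manifold (without boundary) of dimension $n\ge 1$, equipped with a smooth Riemannian metric $g$, a smooth 1-form $X$, a smooth symmetric $(0,2)$ tensor $T$ and a smooth function $U$ which solve the horizon equations $$R_{ab}=\tfrac12 X_aX_b-\nabla_{(a}X_{b)}+T_{ab}-\tfrac1n\left(g^{cd}T_{cd}+2U\right)g_{ab},$$ where $\nabla$ is the Levi-Civita connection of $g$, $R_{ab}$ is its Ricci tensor (with the sign for which $[\nabla_a,\nabla_b]V^a=R_{ab}V^a$ for vector fields $V$, so that round spheres have positive Ricci curvature), round brackets denote symmetrisation with weight one half, and indices are raised and lowered with $g$. Let $\Gamma$ be any smooth strictly positive function on $M$ and let $K$ be the vector field with $K^\flat=\Gamma X+d\Gamma$. Define a 1-form $\beta$ and functions $\alpha$, $A$, $\gamma$ on $M$ by $$\Gamma\beta_a=-\nabla^b(\Gamma T_{ab})+K^bT_{ab}-UK_a+U\nabla_a\Gamma,\qquad \Gamma^2\alpha=\Gamma K^a\beta_a-\tfrac12\nabla_a(\Gamma^2\beta^a),$$ $$A=-\frac{|K|^2}{2\Gamma}+\tfrac12\Delta\Gamma-\tfrac12\nabla_bK^b-\frac1{2\Gamma}K^b\nabla_b\Gamma+\left(1-\tfrac2n\right)\Gamma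 U-\tfrac1n\Gamma g^{cd}T_{cd},$$ $$\gamma=T_{ab}K^aK^b-2\Gamma K^a\beta_a-|K|^2U+\Gamma^2\alpha,$$ where $\Delta=\nabla^a\nabla_a$. Then, with $|\mathcal L_Kg|^2=(\mathcal L_Kg)_{ab}(\mathcal L_Kg)^{ab}$, the following identity holds on $M$: $$\tfrac14|\mathcal L_Kg|^2+\gamma=\nabla^a\left(K^b\nabla_{(a}K_{b)}-AK_a-K_a\nabla_bK^b-\frac1{2\Gamma}K_aK^b\nabla_b\Gamma-\frac{|K|^2}{2\Gamma}K_a-\tfrac12\Gamma^2\beta_a\right)+\nabla_bK^b\left(A+\nabla_aK^a+\frac1\Gamma K^a\nabla_a\Gamma\right).$$ -/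

import Mathlib

open Set Bundle
open scoped Manifold ContDiff Topology

noncomputable section

namespace ExtremalHorizon

/-! ## Tensor calculus in local coordinates

Scalar fields, 1-forms and tensors of rank two on an open subset of `ℝⁿ` are represented by their
component functions. Only their values near the point of evaluation matter. -/

section Coordinates

variable {n : ℕ}

/-- The coordinate space `ℝⁿ`. -/
abbrev Coord (n : ℕ) := EuclideanSpace ℝ (Fin n)

/-- The partial derivative `∂ᵢ f`. -/
def pd (i : Fin n) (f : Coord n → ℝ) (y : Coord n) : ℝ :=
  fderiv ℝ f y (EuclideanSpace.single i 1)

/-- The Christoffel symbol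
`Γ^c_{ab} = ½ g^{cd} (∂_a g_{db} + ∂_b g_{da} - ∂_d g_{ab})` of the Levi-Civita connection. -/
def christoffel (g : Coord n → Matrix (Fin n) (Fin n) ℝ) (c a b : Fin n) (y : Coord n) : ℝ :=
  (1 / 2) * ∑ d, (g y)⁻¹ c d *
    (pd a (fun z => g z d b) y + pd b (fun z => g z d a) y - pd d (fun z => g z a b) y)

/-- The Ricci tensor
`R_{ab} = ∂_c Γ^c_{ab} - ∂_b Γ^c_{ac} + Γ^c_{cd} Γ^d_{ab} - Γ^c_{bd} Γ^d_{ac}`. -/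
def ricci (g : Coord n → Matrix (Fin n) (Fin n) ℝ) (y : Coord n) (a b : Fin n) : ℝ :=
  ∑ c, (pd c (christoffel g c a b) y - pd b (christoffel g c a c) y
    + ∑ d, (christoffel g c c d y * christoffel g d a b y
      - christoffel g c b d y * christoffel g d a c y))

/-- The differential `(df)_a = ∂_a f` of a function. -/
def grad (f : Coord n → ℝ) (y : Coord n) (a : Fin n) : ℝ := pd a f y

/-- The covariant derivative `∇_a θ_b` of a 1-form. -/
def nabla₁ (g : Coord n → Matrix (Fin n) (Fin n) ℝ) (θ : Coord n → Fin n → ℝ)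
    (y : Coord n) (a b : Fin n) : ℝ :=
  pd a (fun z => θ z b) y - ∑ c, christoffel g c a b y * θ y c

/-- The covariant derivative `∇_c S_{ab}` of a tensor of type (0,2). -/
def nabla₂ (g S : Coord n → Matrix (Fin n) (Fin n) ℝ) (y : Coord n) (c a b : Fin n) : ℝ :=
  pd c (fun z => S z a b) y - ∑ d, christoffel g d c a y * S y d b
    - ∑ d, christoffel g d c b y * S y a d

/-- The symmetrised covariant derivative `∇_{(a} θ_{b)}`. -/
def symNabla (g : Coord n → Matrix (Fin n) (Fin n) ℝ) (θ : Coord n → Fin n → ℝ)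
    (y : Coord n) (a b : Fin n) : ℝ :=
  (nabla₁ g θ y a b + nabla₁ g θ y b a) / 2

/-- The inner product `g^{ab} θ_a η_b` of two covectors at `y`. -/
def innerAt (g : Coord n → Matrix (Fin n) (Fin n) ℝ) (y : Coord n) (θ η : Fin n → ℝ) : ℝ :=
  ∑ a, ∑ b, (g y)⁻¹ a b * θ a * η b

/-- The trace `g^{ab} S_{ab}` at `y`. -/
def traceAt (g : Coord n → Matrix (Fin n) (Fin n) ℝ) (y : Coord n)
    (S : Fin n → Fin n → ℝ) : ℝ :=
  ∑ a, ∑ b, (g y)⁻¹ a b * S a b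

/-- The squared norm `g^{ac} g^{bd} S_{ab} S_{cd}` at `y`. -/
def normSqAt (g : Coord n → Matrix (Fin n) (Fin n) ℝ) (y : Coord n)
    (S : Fin n → Fin n → ℝ) : ℝ :=
  ∑ a, ∑ b, ∑ c, ∑ d, (g y)⁻¹ a c * (g y)⁻¹ b d * S a b * S c d

/-- The divergence `∇^a θ_a` of a 1-form. -/
def div₁ (g : Coord n → Matrix (Fin n) (Fin n) ℝ) (θ : Coord n → Fin n → ℝ)
    (y : Coord n) : ℝ :=
  traceAt g y (nabla₁ g θ y)

/-- The divergence `∇^b S_{ab}` of a tensor of type (0,2). -/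
def div₂ (g S : Coord n → Matrix (Fin n) (Fin n) ℝ) (y : Coord n) (a : Fin n) : ℝ :=
  ∑ b, ∑ c, (g y)⁻¹ b c * nabla₂ g S y c a b

/-- The Laplacian `Δ f = ∇^a ∇_a f`. -/
def laplacian (g : Coord n → Matrix (Fin n) (Fin n) ℝ) (f : Coord n → ℝ) (y : Coord n) : ℝ :=
  div₁ g (grad f) y

/-- The components `V_a = g_{ab} V^b` of the 1-form `V♭`. -/
def lower (g : Coord n → Matrix (Fin n) (Fin n) ℝ) (V : Coord n → Fin n → ℝ)
    (y : Coord n) (a : Fin n) : ℝ :=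
  ∑ b, g y a b * V y b

/-- The Lie derivative `(L_V g)_{ab} = V^c ∂_c g_{ab} + g_{cb} ∂_a V^c + g_{ac} ∂_b V^c`. -/
def lieMetric (g : Coord n → Matrix (Fin n) (Fin n) ℝ) (V : Coord n → Fin n → ℝ)
    (y : Coord n) (a b : Fin n) : ℝ :=
  ∑ c, (V y c * pd c (fun z => g z a b) y
    + g y c b * pd a (fun z => V z c) y + g y a c * pd b (fun z => V z c) y)

/-! ### The quantities built from the data `(g, K, Γ, T, U)`

`V` denotes the contravariant components `K^a` of the vector field `K`, and `Γ` is the positive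
function `Γ`. -/

/-- The 1-form `β`, given by
`Γ β_a = -∇^b (Γ T_{ab}) + K^b T_{ab} - U K_a + U ∇_a Γ`. -/
def betaForm (g : Coord n → Matrix (Fin n) (Fin n) ℝ) (V : Coord n → Fin n → ℝ)
    (Γ : Coord n → ℝ) (T : Coord n → Matrix (Fin n) (Fin n) ℝ) (U : Coord n → ℝ)
    (y : Coord n) (a : Fin n) : ℝ :=
  (Γ y)⁻¹ * (-div₂ g (fun z => Γ z • T z) y a + ∑ b, V y b * T y a b
    - U y * lower g V y a + U y * grad Γ y a)

/-- The function `α`, given by `Γ² α = Γ K^a β_a - ½ ∇_a (Γ² β^a)`. -/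
def alphaFun (g : Coord n → Matrix (Fin n) (Fin n) ℝ) (V : Coord n → Fin n → ℝ)
    (Γ : Coord n → ℝ) (T : Coord n → Matrix (Fin n) (Fin n) ℝ) (U : Coord n → ℝ)
    (y : Coord n) : ℝ :=
  (Γ y ^ 2)⁻¹ * (Γ y * ∑ a, V y a * betaForm g V Γ T U y a
    - (1 / 2) * div₁ g (fun z a => Γ z ^ 2 * betaForm g V Γ T U z a) y)

/-- The function
`A = -|K|²/(2Γ) + ½ ΔΓ - ½ ∇_b K^b - (2Γ)⁻¹ K^b ∇_b Γ + (1 - 2/n) Γ U - (1/n) Γ g^{cd} T_{cd}`. -/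
def aFun (g : Coord n → Matrix (Fin n) (Fin n) ℝ) (V : Coord n → Fin n → ℝ)
    (Γ : Coord n → ℝ) (T : Coord n → Matrix (Fin n) (Fin n) ℝ) (U : Coord n → ℝ)
    (y : Coord n) : ℝ :=
  -innerAt g y (lower g V y) (lower g V y) / (2 * Γ y) + (1 / 2) * laplacian g Γ y
    - (1 / 2) * div₁ g (lower g V) y - 1 / (2 * Γ y) * ∑ b, V y b * grad Γ y b
    + (1 - 2 / (n : ℝ)) * Γ y * U y - 1 / (n : ℝ) * Γ y * traceAt g y (T y)

/-- The function `γ = T_{ab} K^a K^b - 2 Γ K^a β_a - |K|² U + Γ² α`. -/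
def gammaFun (g : Coord n → Matrix (Fin n) (Fin n) ℝ) (V : Coord n → Fin n → ℝ)
    (Γ : Coord n → ℝ) (T : Coord n → Matrix (Fin n) (Fin n) ℝ) (U : Coord n → ℝ)
    (y : Coord n) : ℝ :=
  ∑ a, ∑ b, T y a b * V y a * V y b - 2 * Γ y * ∑ a, V y a * betaForm g V Γ T U y a
    - innerAt g y (lower g V y) (lower g V y) * U y + Γ y ^ 2 * alphaFun g V Γ T U y

/-- The 1-form `J_a = K^b ∇_{(a} K_{b)} - A K_a - K_a ∇_b K^b - (2Γ)⁻¹ K_a K^b ∇_b Γ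
- |K|²/(2Γ) K_a - ½ Γ² β_a`. -/
def currentForm (g : Coord n → Matrix (Fin n) (Fin n) ℝ) (V : Coord n → Fin n → ℝ)
    (Γ : Coord n → ℝ) (T : Coord n → Matrix (Fin n) (Fin n) ℝ) (U : Coord n → ℝ)
    (y : Coord n) (a : Fin n) : ℝ :=
  ∑ b, V y b * symNabla g (lower g V) y a b
    - aFun g V Γ T U y * lower g V y a
    - lower g V y a * div₁ g (lower g V) y
    - 1 / (2 * Γ y) * lower g V y a * ∑ b, V y b * grad Γ y b
    - innerAt g y (lower g V y) (lower g V y) / (2 * Γ y) * lower g V y a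
    - (1 / 2) * Γ y ^ 2 * betaForm g V Γ T U y a

end Coordinates

/-! ## Horizon data on a manifold -/

section Manifold

variable {n : ℕ} {M : Type*} [TopologicalSpace M] [ChartedSpace (Coord n) M]

/-- The coordinate vector field `∂ᵢ` of the chart `e`, at the point with coordinates `y`. -/
def coordVec (e : OpenPartialHomeomorph M (Coord n)) (y : Coord n) (i : Fin n) :
    TangentSpace (𝓡 n) (e.symm y) :=
  mfderiv (𝓡 n) (𝓡 n) e.symm y (EuclideanSpace.single i (1 : ℝ) : Coord n)

/-- The coordinate expression of a function. -/
def funIn (e : OpenPartialHomeomorph M (Coord n)) (f : M → ℝ) (y : Coord n) : ℝ :=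
  f (e.symm y)

/-- The components `V^a = dx^a(V)` of a vector field in the chart `e`. -/
def vecIn (e : OpenPartialHomeomorph M (Coord n)) (V : ∀ p : M, TangentSpace (𝓡 n) p)
    (y : Coord n) (a : Fin n) : ℝ :=
  (show Coord n from mfderiv (𝓡 n) (𝓡 n) e (e.symm y) (V (e.symm y))) a

/-- The components `θ_a = θ(∂_a)` of a 1-form in the chart `e`. -/
def formIn (e : OpenPartialHomeomorph M (Coord n))
    (θ : ∀ p : M, TangentSpace (𝓡 n) p →L[ℝ] ℝ) (y : Coord n) (a : Fin n) : ℝ :=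
  θ (e.symm y) (coordVec e y a)

/-- The components `S_{ab} = S(∂_a, ∂_b)` of a tensor of type (0,2) in the chart `e`. -/
def tensorIn (e : OpenPartialHomeomorph M (Coord n))
    (S : ∀ p : M, TangentSpace (𝓡 n) p →L[ℝ] TangentSpace (𝓡 n) p →L[ℝ] ℝ)
    (y : Coord n) : Matrix (Fin n) (Fin n) ℝ :=
  Matrix.of fun a b => S (e.symm y) (coordVec e y a) (coordVec e y b)

/-- The differential `df` of a function, as a 1-form. -/
def dForm (f : M → ℝ) (p : M) : TangentSpace (𝓡 n) p →L[ℝ] ℝ :=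
  mfderiv (𝓡 n) 𝓘(ℝ, ℝ) f p

variable [IsManifold (𝓡 n) ∞ M]

variable (n M) in
/-- Smooth horizon data on `M`: a Riemannian metric `g`, a 1-form `X`, a symmetric tensor `T` of
type (0,2) and a function `U`. -/
structure HorizonData where
  /-- the Riemannian metric -/
  g : ContMDiffRiemannianMetric (𝓡 n) ∞ (Coord n) (fun p : M => TangentSpace (𝓡 n) p)
  /-- the 1-form -/
  X : ∀ p : M, TangentSpace (𝓡 n) p →L[ℝ] ℝ
  smooth_X : ContMDiff (𝓡 n) ((𝓡 n).prod 𝓘(ℝ, Coord n →L[ℝ] ℝ)) ∞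
    (fun p => TotalSpace.mk' (Coord n →L[ℝ] ℝ)
      (E := fun p : M => TangentSpace (𝓡 n) p →L[ℝ] Trivial M ℝ p) p (X p))
  /-- the symmetric tensor -/
  T : ∀ p : M, TangentSpace (𝓡 n) p →L[ℝ] TangentSpace (𝓡 n) p →L[ℝ] ℝ
  symm_T : ∀ (p : M) (v w : TangentSpace (𝓡 n) p), T p v w = T p w v
  smooth_T : ContMDiff (𝓡 n) ((𝓡 n).prod 𝓘(ℝ, Coord n →L[ℝ] Coord n →L[ℝ] ℝ)) ∞
    (fun p => TotalSpace.mk' (Coord n →L[ℝ] Coord n →L[ℝ] ℝ)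
      (E := fun p : M => TangentSpace (𝓡 n) p →L[ℝ] TangentSpace (𝓡 n) p →L[ℝ] Trivial M ℝ p)
      p (T p))
  /-- the function -/
  U : M → ℝ
  smooth_U : ContMDiff (𝓡 n) 𝓘(ℝ, ℝ) ∞ U

/-- The horizon equations
`R_{ab} = ½ X_a X_b - ∇_{(a} X_{b)} + T_{ab} - (1/n) (g^{cd} T_{cd} + 2U) g_{ab}`,
required in every chart of the smooth structure. -/
def HorizonData.SolvesHorizonEquations (D : HorizonData n M) : Prop :=
  ∀ e ∈ IsManifold.maximalAtlas (𝓡 n) ∞ M, ∀ y ∈ e.target, ∀ a b : Fin n,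
    ricci (tensorIn e D.g.inner) y a b =
      (1 / 2) * formIn e D.X y a * formIn e D.X y b
      - symNabla (tensorIn e D.g.inner) (formIn e D.X) y a b
      + tensorIn e D.T y a b
      - 1 / (n : ℝ) * (traceAt (tensorIn e D.g.inner) y (tensorIn e D.T y)
          + 2 * funIn e D.U y) * tensorIn e D.g.inner y a b

end Manifold

end ExtremalHorizon

end

open ExtremalHorizon

/-!
The identity is local, and in a chart it is a computation in tensor calculus.

Write `k = K♭`, `S = ∇_{(a} k_{b)}` and `q = 1/(2Γ)`. Substituting `X = Γ⁻¹ (k - dΓ)` turns the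
horizon equations into
`Γ T_{ab} = Γ R_{ab} - q k_a k_b + q ∂_aΓ ∂_bΓ + S_{ab} - ∇_a∇_bΓ + Γ l g_{ab}`,
where `l = (1/n) (g^{cd} T_{cd} + 2U)` (`horizon_tensor_eq`). Its divergence, contracted with `K`,
is computed in `IsHorizonOn.contract_div₂_T`. The contracted Bianchi identity
`∇^b R_{ab} = ½ ∂_a R` (`IsMetricOn.pd_scalarCurvature`) and the commutation rule
`∇^b∇_b∇_aΓ = ∂_a ΔΓ + R_{ab} ∇^bΓ` (`IsMetricOn.div₂_hessian`) each produce a term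
`R_{ab} K^a ∇^bΓ`, and these cancel. The derivative of the scalar curvature is eliminated with the
trace of the horizon equations (`IsHorizonOn.mul_scalarCurvature`). What remains is
`K^a ∇^b S_{ab}` and derivatives of functions.

On the other side, `|L_K g|² = 4 |S|²` (`IsMetricOn.lieMetric_eq`), and the divergence of
`K^b S_{ab}` is `K^a ∇^b S_{ab} + |S|²` (`IsMetricOn.div₁_contract`). The terms of the current
proportional to `k` combine to a multiple of `k` without any `1/Γ` (`IsHorizonOn.currentForm_eq`),
and `-½ ∇^a(Γ² β_a)` occurs on both sides. The identity then reduces to the formula for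
`K^a ∇^b(Γ T_{ab})`.

For the curvature identities the connection is treated as a family of matrices
`(C_a)^c_b = Γ^c_{ab}`, with curvature `F_{ab} = ∂_a C_b - ∂_b C_a + [C_a, C_b]`. The second Bianchi
identity and the skewness of `F_{ab}` with respect to the metric are then identities between
noncommuting matrices, and only the contractions need indices.
-/

namespace ExtremalHorizon

section Coordinates

variable {n : ℕ} {s : Set (Coord n)}
variable {g : Coord n → Matrix (Fin n) (Fin n) ℝ} {y : Coord n}

/-! ### Partial derivatives of functions and of matrices of functions -/

theorem pd_congr (hs : IsOpen s) {f h : Coord n → ℝ} (H : ∀ z ∈ s, f z = h z) {y : Coord n}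
    (hy : y ∈ s) (i : Fin n) : pd i f y = pd i h y := by
  have : f =ᶠ[𝓝 y] h := Filter.eventuallyEq_of_mem (hs.mem_nhds hy) H
  simp only [pd, this.fderiv_eq]

theorem pd_add {f h : Coord n → ℝ} {y : Coord n} (hf : DifferentiableAt ℝ f y)
    (hh : DifferentiableAt ℝ h y) (i : Fin n) :
    pd i (fun z => f z + h z) y = pd i f y + pd i h y := by
  simp [pd, fderiv_fun_add hf hh]

theorem pd_sub {f h : Coord n → ℝ} {y : Coord n} (hf : DifferentiableAt ℝ f y)
    (hh : DifferentiableAt ℝ h y) (i : Fin n) :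
    pd i (fun z => f z - h z) y = pd i f y - pd i h y := by
  simp [pd, fderiv_fun_sub hf hh]

theorem pd_neg (f : Coord n → ℝ) (y : Coord n) (i : Fin n) :
    pd i (fun z => -f z) y = -pd i f y := by
  simp [pd, fderiv_fun_neg]

theorem pd_mul {f h : Coord n → ℝ} {y : Coord n} (hf : DifferentiableAt ℝ f y)
    (hh : DifferentiableAt ℝ h y) (i : Fin n) :
    pd i (fun z => f z * h z) y = pd i f y * h y + f y * pd i h y := by
  simp [pd, fderiv_fun_mul hf hh]; ring

theorem pd_sum {ι : Type*} (t : Finset ι) {f : ι → Coord n → ℝ} {y : Coord n}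
    (hf : ∀ k ∈ t, DifferentiableAt ℝ (f k) y) (i : Fin n) :
    pd i (fun z => ∑ k ∈ t, f k z) y = ∑ k ∈ t, pd i (f k) y := by
  simp [pd, fderiv_fun_sum hf]

theorem pd_const (c : ℝ) (y : Coord n) (i : Fin n) : pd i (fun _ => c) y = 0 := by
  simp [pd]

theorem diffAt (hs : IsOpen s) {f : Coord n → ℝ} (hf : ContDiffOn ℝ ∞ f s) {y : Coord n}
    (hy : y ∈ s) : DifferentiableAt ℝ f y :=
  (hf.contDiffAt (hs.mem_nhds hy)).differentiableAt (by simp)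

theorem contDiffOn_pd (hs : IsOpen s) {f : Coord n → ℝ} (hf : ContDiffOn ℝ ∞ f s) (i : Fin n) :
    ContDiffOn ℝ ∞ (pd i f) s :=
  (hf.fderiv_of_isOpen hs (m := ∞) (by simp)).clm_apply contDiffOn_const

/-- Partial derivatives commute. -/
theorem pd_comm (hs : IsOpen s) {f : Coord n → ℝ} (hf : ContDiffOn ℝ ∞ f s) {y : Coord n}
    (hy : y ∈ s) (i j : Fin n) : pd i (pd j f) y = pd j (pd i f) y := by
  have h1 := hf.contDiffAt (hs.mem_nhds hy)
  have h2 : DifferentiableAt ℝ (fderiv ℝ f) y :=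
    (h1.fderiv_right (m := 1) (WithTop.coe_le_coe.2 le_top)).differentiableAt (by simp)
  have h3 : IsSymmSndFDerivAt ℝ f y := h1.isSymmSndFDerivAt (by
    simpa using (WithTop.coe_le_coe.2 le_top : ((2 : ℕ∞) : WithTop ℕ∞) ≤ ∞))
  have key : ∀ v w : Coord n,
      fderiv ℝ (fun z => fderiv ℝ f z w) y v = fderiv ℝ (fderiv ℝ f) y v w := by
    intro v w
    simp [fderiv_clm_apply h2 (differentiableAt_const w)]
  exact (key _ _).trans ((h3.eq _ _).trans (key _ _).symm)

/-- The entrywise partial derivative of a matrix of functions. -/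
noncomputable def pdM (i : Fin n) (F : Coord n → Matrix (Fin n) (Fin n) ℝ) (y : Coord n) :
    Matrix (Fin n) (Fin n) ℝ :=
  Matrix.of fun a b => pd i (fun z => F z a b) y

/-- A matrix of functions with smooth entries. -/
def SmoothEntriesOn (F : Coord n → Matrix (Fin n) (Fin n) ℝ) (s : Set (Coord n)) : Prop :=
  ∀ i j, ContDiffOn ℝ ∞ (fun z => F z i j) s

section pdM

variable {F H : Coord n → Matrix (Fin n) (Fin n) ℝ} {y : Coord n}

theorem SmoothEntriesOn.add (hF : SmoothEntriesOn F s) (hH : SmoothEntriesOn H s) :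
    SmoothEntriesOn (fun z => F z + H z) s := fun i j => (hF i j).add (hH i j)

theorem SmoothEntriesOn.sub (hF : SmoothEntriesOn F s) (hH : SmoothEntriesOn H s) :
    SmoothEntriesOn (fun z => F z - H z) s := fun i j => (hF i j).sub (hH i j)

theorem SmoothEntriesOn.mul (hF : SmoothEntriesOn F s) (hH : SmoothEntriesOn H s) :
    SmoothEntriesOn (fun z => F z * H z) s := fun i j => by
  simp only [Matrix.mul_apply]
  exact ContDiffOn.sum fun k _ => (hF i k).mul (hH k j)

theorem SmoothEntriesOn.transpose (hF : SmoothEntriesOn F s) :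
    SmoothEntriesOn (fun z => (F z).transpose) s := fun i j => hF j i

theorem SmoothEntriesOn.pdM (hs : IsOpen s) (hF : SmoothEntriesOn F s) (a : Fin n) :
    SmoothEntriesOn (pdM a F) s := fun i j => contDiffOn_pd hs (hF i j) a

theorem pdM_congr (hs : IsOpen s) (h : ∀ z ∈ s, F z = H z) (hy : y ∈ s) (a : Fin n) :
    pdM a F y = pdM a H y := by
  ext i j
  exact pd_congr hs (fun z hz => by rw [h z hz]) hy a

theorem pdM_add (hs : IsOpen s) (hF : SmoothEntriesOn F s) (hH : SmoothEntriesOn H s)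
    (hy : y ∈ s) (a : Fin n) : pdM a (fun z => F z + H z) y = pdM a F y + pdM a H y := by
  ext i j
  exact pd_add (diffAt hs (hF i j) hy) (diffAt hs (hH i j) hy) a

theorem pdM_sub (hs : IsOpen s) (hF : SmoothEntriesOn F s) (hH : SmoothEntriesOn H s)
    (hy : y ∈ s) (a : Fin n) : pdM a (fun z => F z - H z) y = pdM a F y - pdM a H y := by
  ext i j
  exact pd_sub (diffAt hs (hF i j) hy) (diffAt hs (hH i j) hy) a

theorem pdM_neg (a : Fin n) : pdM a (fun z => -F z) y = -pdM a F y := by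
  ext i j
  exact pd_neg _ _ _

theorem pdM_transpose (a : Fin n) :
    pdM a (fun z => (F z).transpose) y = (pdM a F y).transpose := rfl

theorem pdM_mul (hs : IsOpen s) (hF : SmoothEntriesOn F s) (hH : SmoothEntriesOn H s)
    (hy : y ∈ s) (a : Fin n) :
    pdM a (fun z => F z * H z) y = pdM a F y * H y + F y * pdM a H y := by
  ext i j
  simp only [pdM, Matrix.mul_apply, Matrix.of_apply, Matrix.add_apply]
  rw [pd_sum, ← Finset.sum_add_distrib]
  · exact Finset.sum_congr rfl fun k _ =>
      pd_mul (diffAt hs (hF i k) hy) (diffAt hs (hH k j) hy) a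
  · exact fun k _ => (diffAt hs (hF i k) hy).mul (diffAt hs (hH k j) hy)

theorem pdM_comm (hs : IsOpen s) (hF : SmoothEntriesOn F s) (hy : y ∈ s) (a b : Fin n) :
    pdM a (pdM b F) y = pdM b (pdM a F) y := by
  ext i j
  exact pd_comm hs (hF i j) hy a b

theorem SmoothEntriesOn.inv (hF : SmoothEntriesOn F s) (hu : ∀ z ∈ s, IsUnit (F z).det) :
    SmoothEntriesOn (fun z => (F z)⁻¹) s := fun i j => by
  have hdet : ∀ H : Coord n → Matrix (Fin n) (Fin n) ℝ, SmoothEntriesOn H s →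
      ContDiffOn ℝ ∞ (fun z => (H z).det) s := by
    intro H hH
    simp only [Matrix.det_apply']
    exact ContDiffOn.sum fun σ _ => contDiffOn_const.mul (contDiffOn_prod fun k _ => hH _ _)
  simp only [Matrix.inv_def, Matrix.smul_apply, Ring.inverse_eq_inv', smul_eq_mul,
    Matrix.adjugate_apply]
  refine ((hdet F hF).inv fun z hz => (hu z hz).ne_zero).mul (hdet _ fun k l => ?_)
  by_cases hk : k = j
  · subst hk; simpa using contDiffOn_const
  · simpa [Matrix.updateRow_ne hk] using hF k l

end pdM

/-! ### The Levi-Civita connection in a chart -/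

/-- `g` is a smooth, symmetric and nondegenerate matrix of functions on the open set `s`. -/
structure IsMetricOn (g : Coord n → Matrix (Fin n) (Fin n) ℝ) (s : Set (Coord n)) : Prop where
  isOpen : IsOpen s
  smooth : SmoothEntriesOn g s
  symm : ∀ z ∈ s, (g z).transpose = g z
  isUnit : ∀ z ∈ s, IsUnit (g z).det

/-- The connection matrix `(C_a)^c_b = Γ^c_{ab}`, so that `∇_a = ∂_a + C_a` on vector fields. -/
noncomputable def connMatrix (g : Coord n → Matrix (Fin n) (Fin n) ℝ) (a : Fin n)
    (y : Coord n) : Matrix (Fin n) (Fin n) ℝ :=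
  Matrix.of fun c b => christoffel g c a b y

/-- The curvature matrix `F_{ab} = ∂_a C_b - ∂_b C_a + [C_a, C_b]`, with entries
`(F_{ab})^c_d = R^c_{dab}`. -/
noncomputable def curvMatrix (g : Coord n → Matrix (Fin n) (Fin n) ℝ) (a b : Fin n)
    (y : Coord n) : Matrix (Fin n) (Fin n) ℝ :=
  pdM a (connMatrix g b) y - pdM b (connMatrix g a) y
    + connMatrix g a y * connMatrix g b y - connMatrix g b y * connMatrix g a y


namespace IsMetricOn

theorem smooth_inv (hg : IsMetricOn g s) : SmoothEntriesOn (fun z => (g z)⁻¹) s :=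
  hg.smooth.inv hg.isUnit

theorem smooth_christoffel (hg : IsMetricOn g s) (c a b : Fin n) :
    ContDiffOn ℝ ∞ (christoffel g c a b) s := by
  unfold christoffel
  exact contDiffOn_const.mul (ContDiffOn.sum fun d _ => (hg.smooth_inv c d).mul
    (((contDiffOn_pd hg.isOpen (hg.smooth d b) a).add
      (contDiffOn_pd hg.isOpen (hg.smooth d a) b)).sub
      (contDiffOn_pd hg.isOpen (hg.smooth a b) d)))

theorem smooth_connMatrix (hg : IsMetricOn g s) (a : Fin n) :
    SmoothEntriesOn (connMatrix g a) s := fun c b => hg.smooth_christoffel c a b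

theorem smooth_curvMatrix (hg : IsMetricOn g s) (a b : Fin n) :
    SmoothEntriesOn (curvMatrix g a b) s :=
  ((((hg.smooth_connMatrix b).pdM hg.isOpen a).sub ((hg.smooth_connMatrix a).pdM hg.isOpen b)).add
    ((hg.smooth_connMatrix a).mul (hg.smooth_connMatrix b))).sub
    ((hg.smooth_connMatrix b).mul (hg.smooth_connMatrix a))

theorem apply_comm (hg : IsMetricOn g s) (hy : y ∈ s) (a b : Fin n) : g y a b = g y b a :=
  congrFun (congrFun (hg.symm y hy) b) a

theorem inv_transpose (hg : IsMetricOn g s) (hy : y ∈ s) :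
    ((g y)⁻¹).transpose = (g y)⁻¹ := by
  rw [Matrix.transpose_nonsing_inv, hg.symm y hy]

theorem inv_apply_comm (hg : IsMetricOn g s) (hy : y ∈ s) (a b : Fin n) :
    (g y)⁻¹ a b = (g y)⁻¹ b a :=
  congrFun (congrFun (hg.inv_transpose hy) b) a

theorem pd_apply_comm (hg : IsMetricOn g s) (hy : y ∈ s) (c a b : Fin n) :
    pd c (fun z => g z a b) y = pd c (fun z => g z b a) y :=
  pd_congr hg.isOpen (fun _ hz => hg.apply_comm hz a b) hy c

/-- The Levi-Civita connection is torsion free. -/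
theorem christoffel_comm (hg : IsMetricOn g s) (hy : y ∈ s) (c a b : Fin n) :
    christoffel g c a b y = christoffel g c b a y := by
  unfold christoffel
  congr 1
  refine Finset.sum_congr rfl fun d _ => ?_
  rw [hg.pd_apply_comm hy d a b]
  ring

/-- The Christoffel symbols with the first index lowered. -/
theorem mul_connMatrix_apply (hg : IsMetricOn g s) (hy : y ∈ s) (a c b : Fin n) :
    (g y * connMatrix g a y) c b = (1 / 2) * (pd a (fun z => g z c b) y
      + pd b (fun z => g z c a) y - pd c (fun z => g z a b) y) := by
  set w : Fin n → ℝ := fun d => (1 / 2) * (pd a (fun z => g z d b) y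
      + pd b (fun z => g z d a) y - pd d (fun z => g z a b) y) with hw
  have h1 : ∀ e, connMatrix g a y e b = ((g y)⁻¹.mulVec w) e := by
    intro e
    simp only [connMatrix, christoffel, Matrix.of_apply, Matrix.mulVec, dotProduct, hw,
      Finset.mul_sum]
    exact Finset.sum_congr rfl fun d _ => by ring
  have h2 : (g y * connMatrix g a y) c b = ((g y).mulVec ((g y)⁻¹.mulVec w)) c := by
    rw [Matrix.mul_apply]
    simp only [Matrix.mulVec, dotProduct, h1]
  rw [h2, Matrix.mulVec_mulVec, Matrix.mul_nonsing_inv _ (hg.isUnit y hy), Matrix.one_mulVec]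

/-- The metric is parallel: `∂_a g = C_aᵀ g + g C_a`. -/
theorem pdM_metric (hg : IsMetricOn g s) (hy : y ∈ s) (a : Fin n) :
    pdM a g y = (connMatrix g a y).transpose * g y + g y * connMatrix g a y := by
  have h : (connMatrix g a y).transpose * g y = (g y * connMatrix g a y).transpose := by
    rw [Matrix.transpose_mul, hg.symm y hy]
  ext i j
  rw [h, Matrix.add_apply, Matrix.transpose_apply, hg.mul_connMatrix_apply hy,
    hg.mul_connMatrix_apply hy, hg.pd_apply_comm hy a j i, hg.pd_apply_comm hy i j a,
    hg.pd_apply_comm hy j i a]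
  simp only [pdM, Matrix.of_apply]
  ring

/-- The inverse metric is parallel: `∂_a g⁻¹ = -(C_a g⁻¹ + g⁻¹ C_aᵀ)`. -/
theorem pdM_inv (hg : IsMetricOn g s) (hy : y ∈ s) (a : Fin n) :
    pdM a (fun z => (g z)⁻¹) y =
      -(connMatrix g a y * (g y)⁻¹ + (g y)⁻¹ * (connMatrix g a y).transpose) := by
  have h1 : pdM a (fun z => (g z)⁻¹ * g z) y = 0 := by
    rw [pdM_congr hg.isOpen (H := fun _ => 1)
      (fun z hz => Matrix.nonsing_inv_mul _ (hg.isUnit z hz)) hy]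
    ext i j
    exact pd_const _ _ _
  rw [pdM_mul hg.isOpen hg.smooth_inv hg.smooth hy, hg.pdM_metric hy] at h1
  have hu := hg.isUnit y hy
  have h2 : pdM a (fun z => (g z)⁻¹) y * (g y * (g y)⁻¹) +
      (g y)⁻¹ * (connMatrix g a y).transpose * (g y * (g y)⁻¹) +
      ((g y)⁻¹ * g y) * connMatrix g a y * (g y)⁻¹ = 0 := by
    have := congrArg (· * (g y)⁻¹) h1
    simp only [zero_mul] at this
    rw [← this]
    noncomm_ring
  rw [Matrix.mul_nonsing_inv _ hu, Matrix.nonsing_inv_mul _ hu, mul_one, mul_one, one_mul] at h2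
  rw [eq_neg_iff_add_eq_zero, ← h2]
  abel

end IsMetricOn

/-! ### Covariant derivatives, traces and the Bianchi identities -/

theorem curvMatrix_antisymm (g : Coord n → Matrix (Fin n) (Fin n) ℝ) (a b : Fin n)
    (y : Coord n) : curvMatrix g a b y = -curvMatrix g b a y := by
  unfold curvMatrix
  abel

theorem nabla₂_eq (g S : Coord n → Matrix (Fin n) (Fin n) ℝ) (y : Coord n) (c a b : Fin n) :
    nabla₂ g S y c a b = (pdM c S y - (connMatrix g c y).transpose * S y
      - S y * connMatrix g c y) a b := by
  simp only [nabla₂, pdM, connMatrix, Matrix.sub_apply, Matrix.mul_apply, Matrix.transpose_apply,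
    Matrix.of_apply]
  congr 1
  exact Finset.sum_congr rfl fun d _ => mul_comm _ _

theorem traceAt_eq (g : Coord n → Matrix (Fin n) (Fin n) ℝ) (y : Coord n)
    (S : Matrix (Fin n) (Fin n) ℝ) :
    traceAt g y S = ((g y)⁻¹ * S.transpose).trace := by
  simp [traceAt, Matrix.trace, Matrix.mul_apply]

theorem pd_trace (hs : IsOpen s) {F : Coord n → Matrix (Fin n) (Fin n) ℝ}
    (hF : SmoothEntriesOn F s) (hy : y ∈ s) (c : Fin n) :
    pd c (fun z => (F z).trace) y = (pdM c F y).trace := by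
  simp only [Matrix.trace, Matrix.diag]
  rw [pd_sum _ fun k _ => diffAt hs (hF k k) hy]
  rfl

/-- The covariant derivative `∇_e F_{ab}` of the curvature matrix. -/
noncomputable def nablaCurv (g : Coord n → Matrix (Fin n) (Fin n) ℝ) (e a b : Fin n)
    (y : Coord n) : Matrix (Fin n) (Fin n) ℝ :=
  pdM e (curvMatrix g a b) y + connMatrix g e y * curvMatrix g a b y
    - curvMatrix g a b y * connMatrix g e y
    - ∑ f, christoffel g f e a y • curvMatrix g f b y
    - ∑ f, christoffel g f e b y • curvMatrix g a f y

theorem nablaCurv_antisymm (g : Coord n → Matrix (Fin n) (Fin n) ℝ) (e a b : Fin n)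
    (y : Coord n) : nablaCurv g e a b y = -nablaCurv g e b a y := by
  have h : pdM e (curvMatrix g a b) y = -pdM e (curvMatrix g b a) y := by
    rw [← pdM_neg]
    congr 1
    funext z
    exact curvMatrix_antisymm g a b z
  unfold nablaCurv
  rw [h, curvMatrix_antisymm g a b]
  simp only [curvMatrix_antisymm g _ b, curvMatrix_antisymm g a _, smul_neg,
    Finset.sum_neg_distrib, mul_neg, neg_mul]
  abel

namespace IsMetricOn

/-- The derivative of a metric trace is the trace of the covariant derivative. -/
theorem pd_traceAt (hg : IsMetricOn g s) {S : Coord n → Matrix (Fin n) (Fin n) ℝ}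
    (hS : SmoothEntriesOn S s) (hy : y ∈ s) (c : Fin n) :
    pd c (fun z => traceAt g z (S z)) y = traceAt g y (nabla₂ g S y c) := by
  have h1 : nabla₂ g S y c = (pdM c S y - (connMatrix g c y).transpose * S y
      - S y * connMatrix g c y) := by
    ext a b; exact nabla₂_eq g S y c a b
  simp only [traceAt_eq]
  rw [pd_trace hg.isOpen (hg.smooth_inv.mul hS.transpose) hy,
    pdM_mul hg.isOpen hg.smooth_inv hS.transpose hy, hg.pdM_inv hy, pdM_transpose]
  rw [h1, traceAt_eq]
  simp only [Matrix.transpose_sub, Matrix.transpose_mul, Matrix.transpose_transpose, mul_sub,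
    neg_mul, add_mul, Matrix.trace_add, Matrix.trace_sub, Matrix.trace_neg]
  have h2 : (connMatrix g c y * (g y)⁻¹ * (S y).transpose).trace
      = ((g y)⁻¹ * ((S y).transpose * connMatrix g c y)).trace := by
    rw [Matrix.mul_assoc, Matrix.trace_mul_comm, Matrix.mul_assoc]
  rw [h2, Matrix.mul_assoc]
  ring

/-- The curvature is skew with respect to the metric. -/
theorem curvMatrix_mul_inv_transpose (hg : IsMetricOn g s) (hy : y ∈ s) (a b : Fin n) :
    (curvMatrix g a b y * (g y)⁻¹).transpose = -(curvMatrix g a b y * (g y)⁻¹) := by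
  have hd : ∀ a b, pdM a (pdM b (fun z => (g z)⁻¹)) y =
      -(pdM a (connMatrix g b) y * (g y)⁻¹
        + connMatrix g b y * pdM a (fun z => (g z)⁻¹) y
        + pdM a (fun z => (g z)⁻¹) y * (connMatrix g b y).transpose
        + (g y)⁻¹ * (pdM a (connMatrix g b) y).transpose) := by
    intro a b
    have hC := hg.smooth_connMatrix b
    rw [pdM_congr hg.isOpen (fun z hz => hg.pdM_inv hz b) hy, pdM_neg,
      pdM_add hg.isOpen (hC.mul hg.smooth_inv) (hg.smooth_inv.mul hC.transpose) hy,
      pdM_mul hg.isOpen hC hg.smooth_inv hy, pdM_mul hg.isOpen hg.smooth_inv hC.transpose hy,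
      pdM_transpose]
    abel
  have h := pdM_comm hg.isOpen hg.smooth_inv hy a b
  rw [hd a b, hd b a, hg.pdM_inv hy, hg.pdM_inv hy] at h
  rw [Matrix.transpose_mul, hg.inv_transpose hy]
  simp only [curvMatrix, Matrix.transpose_sub, Matrix.transpose_add, Matrix.transpose_mul]
  linear_combination (norm := noncomm_ring) -h

/-- The second Bianchi identity `∇_{[e} F_{ab]} = 0`. -/
theorem nablaCurv_cyclic (hg : IsMetricOn g s) (hy : y ∈ s) (e a b : Fin n) :
    nablaCurv g e a b y + nablaCurv g a b e y + nablaCurv g b e a y = 0 := by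
  have hF : ∀ e a b, pdM e (curvMatrix g a b) y =
      pdM e (pdM a (connMatrix g b)) y - pdM e (pdM b (connMatrix g a)) y
      + (pdM e (connMatrix g a) y * connMatrix g b y
        + connMatrix g a y * pdM e (connMatrix g b) y)
      - (pdM e (connMatrix g b) y * connMatrix g a y
        + connMatrix g b y * pdM e (connMatrix g a) y) := by
    intro e a b
    have hs := hg.isOpen
    have ha := hg.smooth_connMatrix a
    have hb := hg.smooth_connMatrix b
    rw [← pdM_mul hs ha hb hy, ← pdM_mul hs hb ha hy, ← pdM_sub hs (hb.pdM hs a) (ha.pdM hs b) hy,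
      ← pdM_add hs ((hb.pdM hs a).sub (ha.pdM hs b)) (ha.mul hb) hy,
      ← pdM_sub hs (((hb.pdM hs a).sub (ha.pdM hs b)).add (ha.mul hb)) (hb.mul ha) hy]
    rfl
  have hsum : ∀ e a b, ∑ f, christoffel g f e a y • curvMatrix g f b y
      = -∑ f, christoffel g f a e y • curvMatrix g b f y := by
    intro e a b
    rw [← Finset.sum_neg_distrib]
    refine Finset.sum_congr rfl fun f _ => ?_
    rw [hg.christoffel_comm hy, curvMatrix_antisymm g f b, smul_neg]
  unfold nablaCurv
  rw [hF, hF, hF, hsum e a b, hsum a b e, hsum b e a,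
    pdM_comm hg.isOpen (hg.smooth_connMatrix b) hy e a,
    pdM_comm hg.isOpen (hg.smooth_connMatrix a) hy e b,
    pdM_comm hg.isOpen (hg.smooth_connMatrix e) hy a b]
  simp only [curvMatrix]
  noncomm_ring

theorem nablaCurv_mul_inv_transpose (hg : IsMetricOn g s) (hy : y ∈ s) (e a b : Fin n) :
    (nablaCurv g e a b y * (g y)⁻¹).transpose = -(nablaCurv g e a b y * (g y)⁻¹) := by
  have hF := hg.smooth_curvMatrix a b
  have hskew := fun a b => hg.curvMatrix_mul_inv_transpose hy a b
  have hd : (pdM e (fun z => curvMatrix g a b z * (g z)⁻¹) y).transpose =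
      -pdM e (fun z => curvMatrix g a b z * (g z)⁻¹) y := by
    rw [← pdM_transpose, ← pdM_neg]
    exact pdM_congr hg.isOpen (fun z hz => hg.curvMatrix_mul_inv_transpose hz a b) hy e
  have hN : nablaCurv g e a b y * (g y)⁻¹ =
      pdM e (fun z => curvMatrix g a b z * (g z)⁻¹) y
      + (connMatrix g e y * (curvMatrix g a b y * (g y)⁻¹)
        + curvMatrix g a b y * (g y)⁻¹ * (connMatrix g e y).transpose)
      - ∑ f, christoffel g f e a y • (curvMatrix g f b y * (g y)⁻¹)
      - ∑ f, christoffel g f e b y • (curvMatrix g a f y * (g y)⁻¹) := by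
    rw [pdM_mul hg.isOpen hF hg.smooth_inv hy, hg.pdM_inv hy]
    simp only [← smul_mul_assoc, ← Finset.sum_mul, nablaCurv]
    noncomm_ring
  rw [hN]
  simp only [Matrix.transpose_sub, Matrix.transpose_add, Matrix.transpose_sum,
    Matrix.transpose_smul, hd, hskew, Matrix.transpose_mul _ (curvMatrix g a b y * (g y)⁻¹),
    Matrix.transpose_mul (curvMatrix g a b y * (g y)⁻¹) _, Matrix.transpose_transpose,
    smul_neg, Finset.sum_neg_distrib, mul_neg, neg_mul]
  abel

theorem ricci_eq_sum (hg : IsMetricOn g s) (hy : y ∈ s) (a b : Fin n) :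
    ricci g y a b = ∑ c, curvMatrix g c b y c a := by
  unfold ricci
  refine Finset.sum_congr rfl fun c _ => ?_
  simp only [curvMatrix, Matrix.sub_apply, Matrix.add_apply, Matrix.mul_apply, pdM, connMatrix,
    Matrix.of_apply, Finset.sum_sub_distrib]
  rw [pd_congr hg.isOpen (fun z hz => hg.christoffel_comm hz c a b) hy,
    pd_congr hg.isOpen (fun z hz => hg.christoffel_comm hz c a c) hy]
  have h : ∀ d, christoffel g d a b y = christoffel g d b a y ∧
    christoffel g d a c y = christoffel g d c a y :=
    fun d => ⟨hg.christoffel_comm hy d a b, hg.christoffel_comm hy d a c⟩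
  simp only [h]
  ring

theorem smooth_ricci (hg : IsMetricOn g s) : SmoothEntriesOn (fun z => ricci g z) s :=
  fun a b => (ContDiffOn.sum fun c _ => hg.smooth_curvMatrix c b c a).congr
    fun _ hz => hg.ricci_eq_sum hz a b

/-- The contraction `∇_e R^c_{dcb}` is the covariant derivative `∇_e R_{db}` of the Ricci
tensor. -/
theorem nabla₂_ricci (hg : IsMetricOn g s) (hy : y ∈ s) (e d b : Fin n) :
    nabla₂ g (fun z => ricci g z) y e d b = ∑ c, nablaCurv g e c b y c d := by
  have h1 : pd e (fun z => ricci g z d b) y = ∑ c, pdM e (curvMatrix g c b) y c d := by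
    rw [pd_congr hg.isOpen (fun z hz => hg.ricci_eq_sum hz d b) hy,
      pd_sum _ fun c _ => diffAt hg.isOpen (hg.smooth_curvMatrix c b c d) hy]
    rfl
  simp only [nabla₂, nablaCurv, Matrix.sub_apply, Matrix.add_apply, Matrix.mul_apply,
    Finset.sum_sub_distrib, Finset.sum_add_distrib, h1, hg.ricci_eq_sum hy, Matrix.sum_apply,
    Matrix.smul_apply, smul_eq_mul, connMatrix, Matrix.of_apply, Finset.mul_sum]
  have e1 : ∑ c, ∑ f, christoffel g c e f y * curvMatrix g c b y f d
      = ∑ c, ∑ f, christoffel g f e c y * curvMatrix g f b y c d := Finset.sum_comm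
  have e2 : ∑ c, ∑ f, christoffel g f e d y * curvMatrix g c b y c f
      = ∑ c, ∑ f, curvMatrix g c b y c f * christoffel g f e d y :=
    Finset.sum_congr rfl fun c _ => Finset.sum_congr rfl fun f _ => mul_comm _ _
  have e3 : ∑ d', ∑ c, christoffel g d' e d y * curvMatrix g c b y c d'
      = ∑ c, ∑ f, christoffel g f e d y * curvMatrix g c b y c f := Finset.sum_comm
  have e4 : ∑ f, ∑ c, christoffel g f e b y * curvMatrix g c f y c d
      = ∑ c, ∑ f, christoffel g f e b y * curvMatrix g c f y c d := Finset.sum_comm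
  linear_combination -e1 - e2 - e3 - e4

/-- The contracted Bianchi identity `∂_e R = 2 ∇^c R_{ce}`. -/
theorem pd_scalarCurvature (hg : IsMetricOn g s) (hy : y ∈ s) (e : Fin n) :
    pd e (fun z => traceAt g z (ricci g z)) y =
      2 * ∑ d, ∑ c, (g y)⁻¹ d c * nabla₂ g (fun z => ricci g z) y c d e := by
  rw [hg.pd_traceAt hg.smooth_ricci hy]
  have key : ∀ d b, (∑ c, nablaCurv g e c b y c d) + (∑ c, nablaCurv g c b e y c d)
      + ∑ c, nablaCurv g b e c y c d = 0 := by
    intro d b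
    rw [← Finset.sum_add_distrib, ← Finset.sum_add_distrib]
    refine Finset.sum_eq_zero fun c _ => ?_
    exact congrFun (congrFun (hg.nablaCurv_cyclic hy e c b) c) d
  have h3 : ∀ d b, ∑ c, nablaCurv g b e c y c d = -nabla₂ g (fun z => ricci g z) y b d e := by
    intro d b
    rw [hg.nabla₂_ricci hy, ← Finset.sum_neg_distrib]
    exact Finset.sum_congr rfl fun c _ => by rw [nablaCurv_antisymm]; rfl
  -- skewness moves the contraction to the other matrix index, which gives a Ricci tensor again
  have h2 : ∑ d, ∑ b, (g y)⁻¹ d b * ∑ c, nablaCurv g c b e y c d =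
      -∑ d, ∑ b, (g y)⁻¹ d b * nabla₂ g (fun z => ricci g z) y b d e := by
    have hsk : ∀ c b, ∑ d, (g y)⁻¹ d b * nablaCurv g c b e y c d
        = -∑ d, nablaCurv g c b e y b d * (g y)⁻¹ d c := by
      intro c b
      have := congrFun (congrFun (hg.nablaCurv_mul_inv_transpose hy c b e) b) c
      simp only [Matrix.transpose_apply, Matrix.neg_apply, Matrix.mul_apply] at this
      rw [← this]
      exact Finset.sum_congr rfl fun d _ => mul_comm _ _
    calc ∑ d, ∑ b, (g y)⁻¹ d b * ∑ c, nablaCurv g c b e y c d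
        = ∑ c, ∑ b, ∑ d, (g y)⁻¹ d b * nablaCurv g c b e y c d := by
          simp only [Finset.mul_sum]
          rw [Finset.sum_comm_cycle]
          exact Finset.sum_congr rfl fun c _ => Finset.sum_comm
      _ = -∑ c, ∑ d, (g y)⁻¹ d c * ∑ b, nablaCurv g c b e y b d := by
          simp only [hsk, Finset.sum_neg_distrib, Finset.mul_sum]
          congr 1
          refine Finset.sum_congr rfl fun c _ => ?_
          rw [Finset.sum_comm]
          exact Finset.sum_congr rfl fun d _ => Finset.sum_congr rfl fun b _ => mul_comm _ _
      _ = _ := by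
          simp only [← hg.nabla₂_ricci hy]
          rw [Finset.sum_comm]
  have hsum : ∑ d, ∑ b, (g y)⁻¹ d b * ((∑ c, nablaCurv g e c b y c d)
      + (∑ c, nablaCurv g c b e y c d) + ∑ c, nablaCurv g b e c y c d) = 0 :=
    Finset.sum_eq_zero fun d _ => Finset.sum_eq_zero fun b _ => by rw [key, mul_zero]
  simp only [mul_add, Finset.sum_add_distrib] at hsum
  rw [h2] at hsum
  simp only [h3, ← hg.nabla₂_ricci hy, mul_neg, Finset.sum_neg_distrib] at hsum
  unfold traceAt
  linarith

end IsMetricOn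

/-! ### Divergences -/

/-- A 1-form with smooth components; also used for the components of a vector field. -/
def SmoothFormOn (θ : Coord n → Fin n → ℝ) (s : Set (Coord n)) : Prop :=
  ∀ a, ContDiffOn ℝ ∞ (fun z => θ z a) s

theorem smoothFormOn_grad (hs : IsOpen s) {f : Coord n → ℝ} (hf : ContDiffOn ℝ ∞ f s) :
    SmoothFormOn (grad f) s := fun a => contDiffOn_pd hs hf a

section Linearity

variable {θ η : Coord n → Fin n → ℝ} {S P : Coord n → Matrix (Fin n) (Fin n) ℝ}

theorem div₁_congr (hs : IsOpen s) (h : ∀ z ∈ s, θ z = η z) (hy : y ∈ s) :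
    div₁ g θ y = div₁ g η y := by
  unfold div₁
  congr 1
  funext a b
  unfold nabla₁
  rw [pd_congr hs (fun z hz => by rw [h z hz]) hy, h y hy]

theorem div₁_add (hs : IsOpen s) (hθ : SmoothFormOn θ s) (hη : SmoothFormOn η s) (hy : y ∈ s) :
    div₁ g (fun z a => θ z a + η z a) y = div₁ g θ y + div₁ g η y := by
  simp only [div₁, traceAt, ← Finset.sum_add_distrib]
  refine Finset.sum_congr rfl fun a _ => Finset.sum_congr rfl fun b _ => ?_
  simp only [nabla₁, pd_add (diffAt hs (hθ b) hy) (diffAt hs (hη b) hy), mul_add,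
    Finset.sum_add_distrib]
  ring

/-- The Leibniz rule `∇^a (φ θ_a) = φ ∇^a θ_a + θ_a ∇^a φ`. -/
theorem div₁_mul (hs : IsOpen s) {φ : Coord n → ℝ} (hφ : ContDiffOn ℝ ∞ φ s)
    (hθ : SmoothFormOn θ s) (hy : y ∈ s) :
    div₁ g (fun z a => φ z * θ z a) y = φ y * div₁ g θ y + innerAt g y (grad φ y) (θ y) := by
  simp only [div₁, traceAt, innerAt, Finset.mul_sum, ← Finset.sum_add_distrib]
  refine Finset.sum_congr rfl fun a _ => Finset.sum_congr rfl fun b _ => ?_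
  simp only [nabla₁, pd_mul (diffAt hs hφ hy) (diffAt hs (hθ b) hy), grad,
    mul_left_comm _ (φ y), ← Finset.mul_sum]
  ring

theorem div₂_congr (hs : IsOpen s) (h : ∀ z ∈ s, S z = P z) (hy : y ∈ s) (a : Fin n) :
    div₂ g S y a = div₂ g P y a := by
  unfold div₂
  refine Finset.sum_congr rfl fun b _ => Finset.sum_congr rfl fun c _ => ?_
  rw [nabla₂_eq, nabla₂_eq, pdM_congr hs h hy, h y hy]

theorem div₂_add (hs : IsOpen s) (hS : SmoothEntriesOn S s) (hP : SmoothEntriesOn P s)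
    (hy : y ∈ s) (a : Fin n) :
    div₂ g (fun z => S z + P z) y a = div₂ g S y a + div₂ g P y a := by
  simp only [div₂, ← Finset.sum_add_distrib, ← mul_add]
  refine Finset.sum_congr rfl fun b _ => Finset.sum_congr rfl fun c _ => ?_
  simp only [nabla₂_eq, ← Matrix.add_apply, pdM_add hs hS hP hy]
  rw [Matrix.mul_add, Matrix.add_mul]
  congr 1
  refine congrFun (congrFun ?_ a) b
  abel

/-- The Leibniz rule `∇^b (φ S_{ab}) = φ ∇^b S_{ab} + S_{ab} ∇^b φ`. -/
theorem div₂_smul (hs : IsOpen s) {φ : Coord n → ℝ} (hφ : ContDiffOn ℝ ∞ φ s)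
    (hS : SmoothEntriesOn S s) (hy : y ∈ s) (a : Fin n) :
    div₂ g (fun z => φ z • S z) y a = φ y * div₂ g S y a + innerAt g y (S y a) (grad φ y) := by
  simp only [div₂, innerAt, Finset.mul_sum, ← Finset.sum_add_distrib]
  refine Finset.sum_congr rfl fun b _ => Finset.sum_congr rfl fun c _ => ?_
  simp only [nabla₂, Matrix.smul_apply, smul_eq_mul, grad,
    pd_mul (diffAt hs hφ hy) (diffAt hs (hS a b) hy), mul_left_comm _ (φ y), ← Finset.mul_sum]
  ring

theorem nabla₂_comm_of_symm (hs : IsOpen s) (hS : ∀ z ∈ s, ∀ a b, S z a b = S z b a) (hy : y ∈ s)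
    (c a b : Fin n) : nabla₂ g S y c a b = nabla₂ g S y c b a := by
  unfold nabla₂
  rw [pd_congr hs (fun z hz => hS z hz a b) hy]
  simp only [hS y hy _ b, hS y hy a _]
  ring

/-- The tensor product `θ_a η_b`. -/
def tensorMul (θ η : Coord n → Fin n → ℝ) (y : Coord n) : Matrix (Fin n) (Fin n) ℝ :=
  Matrix.of fun a b => θ y a * η y b

theorem SmoothFormOn.tensorMul (hθ : SmoothFormOn θ s) (hη : SmoothFormOn η s) :
    SmoothEntriesOn (tensorMul θ η) s := fun a b => (hθ a).mul (hη b)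

theorem SmoothEntriesOn.smul {φ : Coord n → ℝ} (hφ : ContDiffOn ℝ ∞ φ s)
    (hS : SmoothEntriesOn S s) : SmoothEntriesOn (fun z => φ z • S z) s :=
  fun a b => hφ.mul (hS a b)

theorem nabla₂_tensorMul (hs : IsOpen s) (hθ : SmoothFormOn θ s) (hη : SmoothFormOn η s)
    (hy : y ∈ s) (c a b : Fin n) :
    nabla₂ g (tensorMul θ η) y c a b = nabla₁ g θ y c a * η y b + θ y a * nabla₁ g η y c b := by
  simp only [nabla₂, nabla₁, tensorMul, Matrix.of_apply,
    pd_mul (diffAt hs (hθ a) hy) (diffAt hs (hη b) hy), mul_left_comm _ (θ y a),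
    ← mul_assoc, ← Finset.sum_mul]
  simp only [mul_assoc, ← Finset.mul_sum]
  ring

/-- `∇^b (θ_a η_b) = θ_a ∇^b η_b + η^b ∇_b θ_a`. -/
theorem div₂_tensorMul (hs : IsOpen s) (hθ : SmoothFormOn θ s) (hη : SmoothFormOn η s)
    (hG : ∀ b c, (g y)⁻¹ b c = (g y)⁻¹ c b) (hy : y ∈ s) (a : Fin n) :
    div₂ g (tensorMul θ η) y a = θ y a * div₁ g η y
      + innerAt g y (η y) (fun c => nabla₁ g θ y c a) := by
  have h : div₁ g η y = ∑ b, ∑ c, (g y)⁻¹ b c * nabla₁ g η y c b := by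
    unfold div₁ traceAt
    rw [Finset.sum_comm]
    exact Finset.sum_congr rfl fun b _ => Finset.sum_congr rfl fun c _ => by rw [hG]
  simp only [div₂, innerAt, h, Finset.mul_sum, ← Finset.sum_add_distrib]
  refine Finset.sum_congr rfl fun b _ => Finset.sum_congr rfl fun c _ => ?_
  rw [nabla₂_tensorMul hs hθ hη hy]
  ring

end Linearity

theorem nabla₁_eq (g : Coord n → Matrix (Fin n) (Fin n) ℝ) (θ : Coord n → Fin n → ℝ)
    (y : Coord n) (a b : Fin n) :
    nabla₁ g θ y a b = pd a (fun z => θ z b) y - ∑ c, θ y c * connMatrix g a y c b := by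
  simp only [nabla₁, connMatrix, Matrix.of_apply, mul_comm]

theorem traceAt_tensorMul (g : Coord n → Matrix (Fin n) (Fin n) ℝ) (θ η : Coord n → Fin n → ℝ)
    (y : Coord n) : traceAt g y (tensorMul θ η y) = innerAt g y (θ y) (η y) := by
  simp [traceAt, innerAt, tensorMul, mul_assoc]

namespace IsMetricOn

section Smooth

variable {θ η : Coord n → Fin n → ℝ} {S : Coord n → Matrix (Fin n) (Fin n) ℝ}

theorem smooth_nabla₁ (hg : IsMetricOn g s) (hθ : SmoothFormOn θ s) :
    SmoothEntriesOn (fun z => nabla₁ g θ z) s := fun a b =>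
  (contDiffOn_pd hg.isOpen (hθ b) a).sub
    (ContDiffOn.sum fun c _ => (hg.smooth_christoffel c a b).mul (hθ c))

theorem smooth_symNabla (hg : IsMetricOn g s) (hθ : SmoothFormOn θ s) :
    SmoothEntriesOn (fun z => symNabla g θ z) s := fun a b =>
  ((hg.smooth_nabla₁ hθ a b).add (hg.smooth_nabla₁ hθ b a)).div_const 2

theorem smooth_traceAt (hg : IsMetricOn g s) (hS : SmoothEntriesOn S s) :
    ContDiffOn ℝ ∞ (fun z => traceAt g z (S z)) s :=
  ContDiffOn.sum fun a _ => ContDiffOn.sum fun b _ => (hg.smooth_inv a b).mul (hS a b)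

theorem smooth_innerAt (hg : IsMetricOn g s) (hθ : SmoothFormOn θ s) (hη : SmoothFormOn η s) :
    ContDiffOn ℝ ∞ (fun z => innerAt g z (θ z) (η z)) s :=
  ContDiffOn.sum fun a _ => ContDiffOn.sum fun b _ =>
    ((hg.smooth_inv a b).mul (hθ a)).mul (hη b)

theorem smooth_div₁ (hg : IsMetricOn g s) (hθ : SmoothFormOn θ s) :
    ContDiffOn ℝ ∞ (div₁ g θ) s := hg.smooth_traceAt (hg.smooth_nabla₁ hθ)

theorem smooth_div₂ (hg : IsMetricOn g s) (hS : SmoothEntriesOn S s) :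
    SmoothFormOn (div₂ g S) s := fun a =>
  ContDiffOn.sum fun b _ => ContDiffOn.sum fun c _ => (hg.smooth_inv b c).mul
    (((contDiffOn_pd hg.isOpen (hS a b) c).sub
      (ContDiffOn.sum fun d _ => (hg.smooth_christoffel d c a).mul (hS d b))).sub
      (ContDiffOn.sum fun d _ => (hg.smooth_christoffel d c b).mul (hS a d)))

theorem smooth_lower (hg : IsMetricOn g s) {V : Coord n → Fin n → ℝ} (hV : SmoothFormOn V s) :
    SmoothFormOn (lower g V) s := fun a =>
  ContDiffOn.sum fun b _ => (hg.smooth a b).mul (hV b)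

end Smooth

theorem innerAt_comm (hg : IsMetricOn g s) (hy : y ∈ s) (θ η : Fin n → ℝ) :
    innerAt g y θ η = innerAt g y η θ := by
  unfold innerAt
  rw [Finset.sum_comm]
  refine Finset.sum_congr rfl fun a _ => Finset.sum_congr rfl fun b _ => ?_
  rw [hg.inv_apply_comm hy]
  ring

/-- Raising the index of `V♭` recovers `V`. -/
theorem sum_inv_mul_lower (hg : IsMetricOn g s) (hy : y ∈ s) (V : Coord n → Fin n → ℝ)
    (a : Fin n) : ∑ b, (g y)⁻¹ a b * lower g V y b = V y a := by
  have : (g y)⁻¹.mulVec ((g y).mulVec (V y)) = V y := by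
    rw [Matrix.mulVec_mulVec, Matrix.nonsing_inv_mul _ (hg.isUnit y hy), Matrix.one_mulVec]
  exact congrFun this a

theorem innerAt_lower (hg : IsMetricOn g s) (hy : y ∈ s) (V : Coord n → Fin n → ℝ)
    (θ : Fin n → ℝ) : innerAt g y θ (lower g V y) = ∑ a, V y a * θ a := by
  unfold innerAt
  refine Finset.sum_congr rfl fun a _ => ?_
  rw [← hg.sum_inv_mul_lower hy V a, Finset.sum_mul]
  exact Finset.sum_congr rfl fun b _ => by ring

/-- `∂_c ⟨θ, η⟩ = ⟨∇_c θ, η⟩ + ⟨θ, ∇_c η⟩`. -/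
theorem pd_innerAt (hg : IsMetricOn g s) {θ η : Coord n → Fin n → ℝ} (hθ : SmoothFormOn θ s)
    (hη : SmoothFormOn η s) (hy : y ∈ s) (c : Fin n) :
    pd c (fun z => innerAt g z (θ z) (η z)) y =
      innerAt g y (nabla₁ g θ y c) (η y) + innerAt g y (θ y) (nabla₁ g η y c) := by
  have h := hg.pd_traceAt (hθ.tensorMul hη) hy c
  simp only [traceAt_tensorMul] at h
  rw [h]
  simp only [traceAt, innerAt, ← Finset.sum_add_distrib]
  refine Finset.sum_congr rfl fun a _ => Finset.sum_congr rfl fun b _ => ?_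
  rw [nabla₂_tensorMul hg.isOpen hθ hη hy]
  ring

theorem div₂_metric (hg : IsMetricOn g s) (hy : y ∈ s) (a : Fin n) : div₂ g g y a = 0 := by
  refine Finset.sum_eq_zero fun b _ => Finset.sum_eq_zero fun c _ => ?_
  rw [nabla₂_eq, hg.pdM_metric hy, add_sub_cancel_left, sub_self, Matrix.zero_apply, mul_zero]

theorem innerAt_metric (hg : IsMetricOn g s) (hy : y ∈ s) (θ : Fin n → ℝ) (a : Fin n) :
    innerAt g y (g y a) θ = θ a := by
  have h : ∀ c, ∑ b, g y a b * (g y)⁻¹ b c = if a = c then 1 else 0 := by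
    intro c
    rw [← Matrix.mul_apply, Matrix.mul_nonsing_inv _ (hg.isUnit y hy), Matrix.one_apply]
  unfold innerAt
  rw [Finset.sum_comm]
  have : ∀ c, ∑ b, (g y)⁻¹ b c * g y a b * θ c = (if a = c then 1 else 0) * θ c := by
    intro c
    rw [← h, Finset.sum_mul]
    exact Finset.sum_congr rfl fun b _ => by ring
  simp [this]

/-- `∇^b (φ g_{ab}) = ∇_a φ`. -/
theorem div₂_smul_metric (hg : IsMetricOn g s) {φ : Coord n → ℝ} (hφ : ContDiffOn ℝ ∞ φ s)
    (hy : y ∈ s) (a : Fin n) : div₂ g (fun z => φ z • g z) y a = pd a φ y := by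
  rw [div₂_smul hg.isOpen hφ hg.smooth hy, hg.div₂_metric hy, hg.innerAt_metric hy, mul_zero,
    zero_add, grad]

/-- The Hessian of a function is symmetric. -/
theorem nabla₁_grad_comm (hg : IsMetricOn g s) {f : Coord n → ℝ} (hf : ContDiffOn ℝ ∞ f s)
    (hy : y ∈ s) (a b : Fin n) : nabla₁ g (grad f) y a b = nabla₁ g (grad f) y b a := by
  unfold nabla₁
  congr 1
  · exact pd_comm hg.isOpen hf hy a b
  · exact Finset.sum_congr rfl fun c _ => by rw [hg.christoffel_comm hy]

/-- The Ricci identity `[∇_c, ∇_a] θ_b = -R^d_{bca} θ_d`. -/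
theorem nabla₂_nabla₁_sub (hg : IsMetricOn g s) {θ : Coord n → Fin n → ℝ}
    (hθ : SmoothFormOn θ s) (hy : y ∈ s) (c a b : Fin n) :
    nabla₂ g (fun z => nabla₁ g θ z) y c a b - nabla₂ g (fun z => nabla₁ g θ z) y a c b =
      -∑ d, θ y d * curvMatrix g c a y d b := by
  have hpd : ∀ c a, pd c (fun z => nabla₁ g θ z a b) y =
      pd c (pd a (fun z => θ z b)) y - (∑ d, pd c (fun z => θ z d) y * connMatrix g a y d b
        + ∑ d, θ y d * pdM c (connMatrix g a) y d b) := by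
    intro c a
    have h1 : ∀ d ∈ (Finset.univ : Finset (Fin n)),
        DifferentiableAt ℝ (fun z => θ z d * connMatrix g a z d b) y := fun d _ =>
      (diffAt hg.isOpen (hθ d) hy).mul (diffAt hg.isOpen (hg.smooth_connMatrix a d b) hy)
    simp only [nabla₁_eq]
    rw [pd_sub (diffAt hg.isOpen (contDiffOn_pd hg.isOpen (hθ b) a) hy)
      (DifferentiableAt.fun_sum h1), pd_sum _ h1, ← Finset.sum_add_distrib]
    congr 1
    exact Finset.sum_congr rfl fun d _ =>
      pd_mul (diffAt hg.isOpen (hθ d) hy) (diffAt hg.isOpen (hg.smooth_connMatrix a d b) hy) c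
  have hsym : ∑ d, christoffel g d c a y * nabla₁ g θ y d b
      = ∑ d, christoffel g d a c y * nabla₁ g θ y d b :=
    Finset.sum_congr rfl fun d _ => by rw [hg.christoffel_comm hy]
  have hexp : ∀ c a, ∑ d, christoffel g d c b y * nabla₁ g θ y a d =
      ∑ d, pd a (fun z => θ z d) y * connMatrix g c y d b
        - ∑ d, θ y d * (connMatrix g a y * connMatrix g c y) d b := by
    intro c a
    have h2 : ∑ d, θ y d * (connMatrix g a y * connMatrix g c y) d b =
        ∑ d, (∑ e, θ y e * connMatrix g a y e d) * connMatrix g c y d b := by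
      simp only [Matrix.mul_apply, Finset.mul_sum, Finset.sum_mul]
      rw [Finset.sum_comm]
      exact Finset.sum_congr rfl fun d _ => Finset.sum_congr rfl fun e _ => by ring
    rw [h2, ← Finset.sum_sub_distrib]
    refine Finset.sum_congr rfl fun d _ => ?_
    rw [nabla₁_eq]
    simp only [connMatrix, Matrix.of_apply]
    ring
  simp only [nabla₂, hpd, hexp, hsym, curvMatrix, Matrix.sub_apply, Matrix.add_apply, mul_sub,
    mul_add, Finset.sum_sub_distrib, Finset.sum_add_distrib]
  rw [pd_comm hg.isOpen (hθ b) hy c a]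
  ring

/-- The commutation rule behind Bochner's formula,
`∇^b ∇_b ∇_a f = ∇_a Δf + R_{ab} ∇^b f`; it is stated with `R_{ba}` in place of `R_{ab}`. -/
theorem div₂_hessian (hg : IsMetricOn g s) {f : Coord n → ℝ} (hf : ContDiffOn ℝ ∞ f s)
    (hy : y ∈ s) (a : Fin n) :
    div₂ g (fun z => nabla₁ g (grad f) z) y a = pd a (laplacian g f) y
      + innerAt g y (fun b => ricci g y b a) (grad f y) := by
  have hgr := smoothFormOn_grad hg.isOpen hf
  have hL : pd a (laplacian g f) y =
      ∑ b, ∑ c, (g y)⁻¹ b c * nabla₂ g (fun z => nabla₁ g (grad f) z) y a b c :=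
    hg.pd_traceAt (hg.smooth_nabla₁ hgr) hy a
  have hN : ∀ b c, nabla₂ g (fun z => nabla₁ g (grad f) z) y a c b
      = nabla₂ g (fun z => nabla₁ g (grad f) z) y a b c := fun b c =>
    nabla₂_comm_of_symm hg.isOpen (fun z hz => hg.nabla₁_grad_comm hf hz) hy a c b
  have hR : innerAt g y (fun b => ricci g y b a) (grad f y) =
      -∑ b, ∑ c, (g y)⁻¹ b c * ∑ d, grad f y d * curvMatrix g c a y d b := by
    have hsk : ∀ c d, ∑ b, (g y)⁻¹ b c * curvMatrix g c a y d b
        = -∑ b, curvMatrix g c a y c b * (g y)⁻¹ b d := by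
      intro c d
      have := congrFun (congrFun (hg.curvMatrix_mul_inv_transpose hy c a) c) d
      simp only [Matrix.transpose_apply, Matrix.neg_apply, Matrix.mul_apply] at this
      rw [← this]
      exact Finset.sum_congr rfl fun b _ => mul_comm _ _
    have h1 : ∑ b, ∑ c, (g y)⁻¹ b c * ∑ d, grad f y d * curvMatrix g c a y d b
        = ∑ c, ∑ d, grad f y d * ∑ b, (g y)⁻¹ b c * curvMatrix g c a y d b := by
      rw [Finset.sum_comm]
      refine Finset.sum_congr rfl fun c _ => ?_
      simp only [Finset.mul_sum]
      rw [Finset.sum_comm]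
      exact Finset.sum_congr rfl fun d _ => Finset.sum_congr rfl fun b _ => by ring
    rw [h1]
    simp only [hsk, mul_neg, Finset.sum_neg_distrib, neg_neg, innerAt, hg.ricci_eq_sum hy,
      Finset.mul_sum, Finset.sum_mul]
    rw [Finset.sum_comm_cycle]
    refine Finset.sum_congr rfl fun c _ => ?_
    rw [Finset.sum_comm]
    exact Finset.sum_congr rfl fun d _ => Finset.sum_congr rfl fun b _ => by ring
  rw [hL, hR, ← Finset.sum_neg_distrib, ← Finset.sum_add_distrib]
  unfold div₂
  refine Finset.sum_congr rfl fun b _ => ?_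
  rw [← Finset.sum_neg_distrib, ← Finset.sum_add_distrib]
  refine Finset.sum_congr rfl fun c _ => ?_
  have h2 := hg.nabla₂_nabla₁_sub hgr hy c a b
  rw [hN b c] at h2
  rw [← mul_neg, ← h2]
  ring

theorem pd_lower (hg : IsMetricOn g s) {V : Coord n → Fin n → ℝ} (hV : SmoothFormOn V s)
    (hy : y ∈ s) (a c : Fin n) : pd a (fun z => lower g V z c) y =
      ∑ d, (pd a (fun z => g z c d) y * V y d + g y c d * pd a (fun z => V z d) y) := by
  have hd : ∀ d ∈ (Finset.univ : Finset (Fin n)),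
      DifferentiableAt ℝ (fun z => g z c d * V z d) y := fun d _ =>
    (diffAt hg.isOpen (hg.smooth c d) hy).mul (diffAt hg.isOpen (hV d) hy)
  refine (pd_sum _ hd a).trans (Finset.sum_congr rfl fun d _ => ?_)
  exact pd_mul (diffAt hg.isOpen (hg.smooth c d) hy) (diffAt hg.isOpen (hV d) hy) a

/-- The partial derivatives of the components `V^b = g^{bc} V_c`, in terms of `∇_a V_c`. -/
theorem pd_raised (hg : IsMetricOn g s) {V : Coord n → Fin n → ℝ} (hV : SmoothFormOn V s)
    (hy : y ∈ s) (a b : Fin n) :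
    pd a (fun z => V z b) y = ∑ c, (g y)⁻¹ b c * nabla₁ g (lower g V) y a c
      - ∑ c, christoffel g b a c y * V y c := by
  have hk : ∀ c, nabla₁ g (lower g V) y a c =
      ∑ d, g y c d * (pd a (fun z => V z d) y + ∑ e, christoffel g d a e y * V y e) := by
    intro c
    have h2 : ∀ d, pd a (fun z => g z c d) y =
        ∑ e, christoffel g e a c y * g y e d + ∑ e, g y c e * christoffel g e a d y := by
      intro d
      have := congrFun (congrFun (hg.pdM_metric hy a) c) d
      simpa only [pdM, connMatrix, Matrix.of_apply, Matrix.add_apply, Matrix.mul_apply,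
        Matrix.transpose_apply] using this
    rw [nabla₁, hg.pd_lower hV hy]
    simp only [h2, lower, add_mul, mul_add, Finset.sum_add_distrib, Finset.mul_sum,
      Finset.sum_mul]
    have h3 : ∑ d, ∑ e, christoffel g e a c y * g y e d * V y d
        = ∑ e, ∑ d, christoffel g e a c y * (g y e d * V y d) := by
      rw [Finset.sum_comm]; simp only [mul_assoc]
    have h4 : ∑ d, ∑ e, g y c e * christoffel g e a d y * V y d
        = ∑ d, ∑ e, g y c d * (christoffel g d a e y * V y e) := by
      rw [Finset.sum_comm]; simp only [mul_assoc]
    rw [h3, h4]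
    ring
  have h := hg.sum_inv_mul_lower hy
    (fun z d => pd a (fun z => V z d) z + ∑ e, christoffel g d a e z * V z e) b
  simp only [hk]
  unfold lower at h
  rw [h]
  ring

/-- `(L_V g)_{ab} = 2 ∇_{(a} V_{b)}`. -/
theorem lieMetric_eq (hg : IsMetricOn g s) {V : Coord n → Fin n → ℝ} (hV : SmoothFormOn V s)
    (hy : y ∈ s) (a b : Fin n) :
    lieMetric g V y a b = 2 * symNabla g (lower g V) y a b := by
  have h2 : ∑ c, christoffel g c a b y * lower g V y c = ∑ c, V y c * ((1 / 2) *
      (pd a (fun z => g z c b) y + pd b (fun z => g z c a) y - pd c (fun z => g z a b) y)) := by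
    simp only [← hg.mul_connMatrix_apply hy, lower, Matrix.mul_apply, connMatrix,
      Matrix.of_apply, Finset.mul_sum]
    rw [Finset.sum_comm]
    refine Finset.sum_congr rfl fun c _ => Finset.sum_congr rfl fun d _ => ?_
    rw [hg.apply_comm hy d c]
    ring
  have h3 : ∑ c, christoffel g c b a y * lower g V y c
      = ∑ c, christoffel g c a b y * lower g V y c :=
    Finset.sum_congr rfl fun c _ => by rw [hg.christoffel_comm hy]
  simp only [symNabla, nabla₁, hg.pd_lower hV hy, h3, h2, lieMetric, ← Finset.sum_sub_distrib,
    ← Finset.sum_add_distrib, Finset.sum_div, Finset.mul_sum]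
  refine Finset.sum_congr rfl fun c _ => ?_
  rw [hg.pd_apply_comm hy a c b, hg.pd_apply_comm hy b c a, hg.apply_comm hy c b]
  ring

/-- `∇^a (V^b S_{ba}) = V^b ∇^a S_{ba} + S_{ba} ∇^a V^b`. -/
theorem div₁_contract (hg : IsMetricOn g s) {V : Coord n → Fin n → ℝ} (hV : SmoothFormOn V s)
    {S : Coord n → Matrix (Fin n) (Fin n) ℝ} (hS : SmoothEntriesOn S s) (hy : y ∈ s) :
    div₁ g (fun z a => ∑ b, V z b * S z b a) y = ∑ b, V y b * div₂ g S y b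
      + ∑ a, ∑ b, ∑ c, ∑ d,
        (g y)⁻¹ a c * (g y)⁻¹ b d * nabla₁ g (lower g V) y a b * S y d c := by
  have h1 : ∀ a c, nabla₁ g (fun z a => ∑ b, V z b * S z b a) y a c =
      ∑ b, V y b * nabla₂ g S y a b c
      + ∑ d, ∑ b, (g y)⁻¹ b d * nabla₁ g (lower g V) y a b * S y d c := by
    intro a c
    have hd : ∀ b ∈ (Finset.univ : Finset (Fin n)),
        DifferentiableAt ℝ (fun z => V z b * S z b c) y := fun b _ =>
      (diffAt hg.isOpen (hV b) hy).mul (diffAt hg.isOpen (hS b c) hy)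
    have h2 : pd a (fun z => ∑ b, V z b * S z b c) y =
        ∑ b, (pd a (fun z => V z b) y * S y b c + V y b * pd a (fun z => S z b c) y) := by
      rw [pd_sum _ hd]
      exact Finset.sum_congr rfl fun b _ =>
        pd_mul (diffAt hg.isOpen (hV b) hy) (diffAt hg.isOpen (hS b c) hy) a
    have h3 : ∑ d, ∑ b, (g y)⁻¹ b d * nabla₁ g (lower g V) y a b * S y d c =
        ∑ b, (pd a (fun z => V z b) y + ∑ d, christoffel g b a d y * V y d) * S y b c := by
      refine Finset.sum_congr rfl fun d _ => ?_
      rw [hg.pd_raised hV hy, sub_add_cancel, Finset.sum_mul]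
      exact Finset.sum_congr rfl fun b _ => by rw [hg.inv_apply_comm hy]
    rw [h3]
    simp only [nabla₁, nabla₂, h2, mul_sub, add_mul, Finset.sum_add_distrib,
      Finset.sum_sub_distrib, Finset.mul_sum, Finset.sum_mul]
    have e1 : ∑ b, ∑ d, christoffel g b a d y * V y d * S y b c
        = ∑ b, ∑ d, V y b * (christoffel g d a b y * S y d c) := by
      rw [Finset.sum_comm]
      exact Finset.sum_congr rfl fun b _ => Finset.sum_congr rfl fun d _ => by ring
    have e2 : ∑ e, ∑ b, christoffel g e a c y * (V y b * S y b e)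
        = ∑ b, ∑ e, V y b * (christoffel g e a c y * S y b e) := by
      rw [Finset.sum_comm]
      exact Finset.sum_congr rfl fun b _ => Finset.sum_congr rfl fun d _ => by ring
    rw [e1, e2]
    ring
  simp only [div₁, traceAt, h1, mul_add, Finset.sum_add_distrib]
  congr 1
  · simp only [div₂, Finset.mul_sum]
    rw [Finset.sum_comm_cycle]
    refine Finset.sum_congr rfl fun b _ => ?_
    rw [Finset.sum_comm]
    refine Finset.sum_congr rfl fun c _ => Finset.sum_congr rfl fun a _ => ?_
    rw [hg.inv_apply_comm hy]
    ring
  · refine Finset.sum_congr rfl fun a _ => ?_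
    simp only [Finset.mul_sum]
    rw [Finset.sum_comm_cycle]
    exact Finset.sum_congr rfl fun b _ => Finset.sum_congr rfl fun c _ =>
      Finset.sum_congr rfl fun d _ => by ring

end IsMetricOn

/-! ### Derivatives along a vector field -/

/-- The derivative `V^a ∂_a φ` of a function along a vector field. -/
noncomputable def dirDeriv (V : Coord n → Fin n → ℝ) (φ : Coord n → ℝ) (y : Coord n) : ℝ :=
  ∑ a, V y a * pd a φ y

section dirDeriv

variable {V : Coord n → Fin n → ℝ} {φ ψ : Coord n → ℝ}

theorem dirDeriv_congr (hs : IsOpen s) (h : ∀ z ∈ s, φ z = ψ z) (hy : y ∈ s) :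
    dirDeriv V φ y = dirDeriv V ψ y :=
  Finset.sum_congr rfl fun a _ => by rw [pd_congr hs h hy]

theorem dirDeriv_add (hs : IsOpen s) (hφ : ContDiffOn ℝ ∞ φ s) (hψ : ContDiffOn ℝ ∞ ψ s)
    (hy : y ∈ s) : dirDeriv V (fun z => φ z + ψ z) y = dirDeriv V φ y + dirDeriv V ψ y := by
  simp only [dirDeriv, ← Finset.sum_add_distrib, ← mul_add,
    pd_add (diffAt hs hφ hy) (diffAt hs hψ hy)]

theorem dirDeriv_mul (hs : IsOpen s) (hφ : ContDiffOn ℝ ∞ φ s) (hψ : ContDiffOn ℝ ∞ ψ s)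
    (hy : y ∈ s) :
    dirDeriv V (fun z => φ z * ψ z) y = dirDeriv V φ y * ψ y + φ y * dirDeriv V ψ y := by
  simp only [dirDeriv, pd_mul (diffAt hs hφ hy) (diffAt hs hψ hy), mul_add,
    Finset.sum_add_distrib, Finset.sum_mul, Finset.mul_sum, mul_assoc, mul_left_comm (φ y)]

theorem dirDeriv_const_mul (hs : IsOpen s) (c : ℝ) (hψ : ContDiffOn ℝ ∞ ψ s)
    (hy : y ∈ s) : dirDeriv V (fun z => c * ψ z) y = c * dirDeriv V ψ y := by
  rw [dirDeriv_mul hs contDiffOn_const hψ hy]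
  simp [dirDeriv, pd_const]

end dirDeriv

theorem traceAt_add (g : Coord n → Matrix (Fin n) (Fin n) ℝ) (y : Coord n)
    (S P : Matrix (Fin n) (Fin n) ℝ) : traceAt g y (S + P) = traceAt g y S + traceAt g y P := by
  simp only [traceAt, Matrix.add_apply, mul_add, Finset.sum_add_distrib]

theorem traceAt_smul (g : Coord n → Matrix (Fin n) (Fin n) ℝ) (y : Coord n) (c : ℝ)
    (S : Matrix (Fin n) (Fin n) ℝ) : traceAt g y (c • S) = c * traceAt g y S := by
  simp only [traceAt, Matrix.smul_apply, smul_eq_mul, Finset.mul_sum, mul_left_comm]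

theorem innerAt_mul_left (g : Coord n → Matrix (Fin n) (Fin n) ℝ) (y : Coord n) (c : ℝ)
    (θ η : Fin n → ℝ) : innerAt g y (fun b => c * θ b) η = c * innerAt g y θ η := by
  simp only [innerAt, Finset.mul_sum, mul_left_comm, mul_assoc]

/-- `|2S|² = 4|S|²`. -/
theorem normSqAt_two_mul (g : Coord n → Matrix (Fin n) (Fin n) ℝ) (y : Coord n)
    (S : Fin n → Fin n → ℝ) : normSqAt g y (fun a b => 2 * S a b) = 4 * normSqAt g y S := by
  simp only [normSqAt, Finset.mul_sum]
  refine Finset.sum_congr rfl fun a _ => Finset.sum_congr rfl fun b _ =>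
    Finset.sum_congr rfl fun c _ => Finset.sum_congr rfl fun d _ => by ring

/-- Contracting `∇θ` with a symmetric tensor only sees the symmetric part of `∇θ`. -/
theorem sum_nabla₁_symNabla (g : Coord n → Matrix (Fin n) (Fin n) ℝ) (y : Coord n)
    (θ : Coord n → Fin n → ℝ) :
    ∑ a, ∑ b, ∑ c, ∑ d, (g y)⁻¹ a c * (g y)⁻¹ b d * nabla₁ g θ y a b * symNabla g θ y d c
      = normSqAt g y (symNabla g θ y) := by
  have hsw : ∑ a, ∑ b, ∑ c, ∑ d,
        (g y)⁻¹ a c * (g y)⁻¹ b d * nabla₁ g θ y b a * symNabla g θ y d c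
      = ∑ a, ∑ b, ∑ c, ∑ d,
        (g y)⁻¹ a c * (g y)⁻¹ b d * nabla₁ g θ y a b * symNabla g θ y d c := by
    rw [Finset.sum_comm]
    refine Finset.sum_congr rfl fun a _ => Finset.sum_congr rfl fun b _ => ?_
    rw [Finset.sum_comm]
    refine Finset.sum_congr rfl fun c _ => Finset.sum_congr rfl fun d _ => ?_
    simp only [symNabla]
    ring
  have h2 : normSqAt g y (symNabla g θ y) =
      (1 / 2) * (∑ a, ∑ b, ∑ c, ∑ d,
          (g y)⁻¹ a c * (g y)⁻¹ b d * nabla₁ g θ y a b * symNabla g θ y d c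
        + ∑ a, ∑ b, ∑ c, ∑ d,
          (g y)⁻¹ a c * (g y)⁻¹ b d * nabla₁ g θ y b a * symNabla g θ y d c) := by
    simp only [normSqAt, ← Finset.sum_add_distrib, Finset.mul_sum]
    refine Finset.sum_congr rfl fun a _ => Finset.sum_congr rfl fun b _ =>
      Finset.sum_congr rfl fun c _ => Finset.sum_congr rfl fun d _ => ?_
    simp only [symNabla]
    ring
  rw [h2, hsw]
  ring

namespace IsMetricOn

theorem traceAt_metric (hg : IsMetricOn g s) (hy : y ∈ s) : traceAt g y (g y) = n := by
  rw [traceAt_eq, hg.symm y hy, Matrix.nonsing_inv_mul _ (hg.isUnit y hy), Matrix.trace_one,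
    Fintype.card_fin]

theorem traceAt_symNabla (hg : IsMetricOn g s) (hy : y ∈ s) (θ : Coord n → Fin n → ℝ) :
    traceAt g y (symNabla g θ y) = div₁ g θ y := by
  have h : ∑ a, ∑ b, (g y)⁻¹ a b * nabla₁ g θ y b a
      = ∑ a, ∑ b, (g y)⁻¹ a b * nabla₁ g θ y a b := by
    rw [Finset.sum_comm]
    exact Finset.sum_congr rfl fun a _ => Finset.sum_congr rfl fun b _ => by
      rw [hg.inv_apply_comm hy]
  simp only [traceAt, symNabla, div₁, mul_div_assoc', mul_add, ← Finset.sum_div,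
    Finset.sum_add_distrib, h]
  ring

section Contraction

variable {V : Coord n → Fin n → ℝ}

theorem innerAt_grad_lower (hg : IsMetricOn g s) (hy : y ∈ s) (φ : Coord n → ℝ) :
    innerAt g y (grad φ y) (lower g V y) = dirDeriv V φ y := hg.innerAt_lower hy V _

/-- `V^a ∂_a |θ|² = 2 V^a ⟨θ, ∇_a θ⟩`. -/
theorem dirDeriv_innerAt_self (hg : IsMetricOn g s) {θ : Coord n → Fin n → ℝ}
    (hθ : SmoothFormOn θ s) (hy : y ∈ s) :
    dirDeriv V (fun z => innerAt g z (θ z) (θ z)) y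
      = 2 * ∑ a, V y a * innerAt g y (θ y) (nabla₁ g θ y a) := by
  rw [Finset.mul_sum]
  refine Finset.sum_congr rfl fun a _ => ?_
  rw [hg.pd_innerAt hθ hθ hy, hg.innerAt_comm hy (nabla₁ g θ y a)]
  ring

/-- `V^a ∇^b (φ V_a V_b) = φ (|V|² ∇^b V_b + ½ V^a ∂_a |V|²) + |V|² V^a ∂_a φ`. -/
theorem contract_div₂_lower (hg : IsMetricOn g s) (hV : SmoothFormOn V s) {φ : Coord n → ℝ}
    (hφ : ContDiffOn ℝ ∞ φ s) (hy : y ∈ s) :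
    ∑ a, V y a * div₂ g (fun z => φ z • tensorMul (lower g V) (lower g V) z) y a =
      φ y * (innerAt g y (lower g V y) (lower g V y) * div₁ g (lower g V) y
        + (1 / 2) * dirDeriv V (fun z => innerAt g z (lower g V z) (lower g V z)) y)
      + innerAt g y (lower g V y) (lower g V y) * dirDeriv V φ y := by
  have hk := hg.smooth_lower hV
  have h1 : ∑ a, V y a * innerAt g y (lower g V y) (fun c => nabla₁ g (lower g V) y c a)
      = ∑ a, V y a * innerAt g y (lower g V y) (nabla₁ g (lower g V) y a) := by
    simp only [hg.innerAt_comm hy (lower g V y), hg.innerAt_lower hy, Finset.mul_sum]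
    rw [Finset.sum_comm]
    exact Finset.sum_congr rfl fun a _ => Finset.sum_congr rfl fun b _ => by ring
  have h2 : ∀ a, innerAt g y (tensorMul (lower g V) (lower g V) y a) (grad φ y)
      = lower g V y a * dirDeriv V φ y := by
    intro a
    rw [← hg.innerAt_grad_lower hy φ, hg.innerAt_comm hy (grad φ y), ← innerAt_mul_left]
    rfl
  simp only [div₂_smul hg.isOpen hφ (hk.tensorMul hk) hy, h2,
    div₂_tensorMul hg.isOpen hk hk (hg.inv_apply_comm hy) hy]
  rw [hg.dirDeriv_innerAt_self hk hy, ← h1, hg.innerAt_lower hy V]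
  simp only [mul_add, Finset.sum_add_distrib, Finset.mul_sum, Finset.sum_mul]
  congr 1
  · congr 1
    · exact Finset.sum_congr rfl fun a _ => by ring
    · exact Finset.sum_congr rfl fun a _ => by ring
  · exact Finset.sum_congr rfl fun a _ => by ring

/-- `V^a ∇^b (φ ∂_a f ∂_b f) = φ (V^a ∂_a f Δf + ½ V^a ∂_a |df|²) + V^a ∂_a f ⟨df, dφ⟩`. -/
theorem contract_div₂_grad (hg : IsMetricOn g s) {f φ : Coord n → ℝ} (hf : ContDiffOn ℝ ∞ f s)
    (hφ : ContDiffOn ℝ ∞ φ s) (hy : y ∈ s) :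
    ∑ a, V y a * div₂ g (fun z => φ z • tensorMul (grad f) (grad f) z) y a =
      φ y * (dirDeriv V f y * laplacian g f y
        + (1 / 2) * dirDeriv V (fun z => innerAt g z (grad f z) (grad f z)) y)
      + dirDeriv V f y * innerAt g y (grad f y) (grad φ y) := by
  have hu := smoothFormOn_grad hg.isOpen hf
  have h1 : ∀ a, (fun c => nabla₁ g (grad f) y c a) = nabla₁ g (grad f) y a := fun a =>
    funext fun c => hg.nabla₁_grad_comm hf hy c a
  have h2 : ∀ a, innerAt g y (tensorMul (grad f) (grad f) y a) (grad φ y)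
      = grad f y a * innerAt g y (grad f y) (grad φ y) := fun a => by
    rw [← innerAt_mul_left]
    rfl
  simp only [div₂_smul hg.isOpen hφ (hu.tensorMul hu) hy, h2,
    div₂_tensorMul hg.isOpen hu hu (hg.inv_apply_comm hy) hy, h1]
  rw [hg.dirDeriv_innerAt_self hu hy]
  simp only [dirDeriv, grad, laplacian, mul_add, Finset.sum_add_distrib, Finset.mul_sum,
    Finset.sum_mul]
  congr 1
  · congr 1
    · exact Finset.sum_congr rfl fun a _ => by ring
    · exact Finset.sum_congr rfl fun a _ => by ring
  · exact Finset.sum_congr rfl fun a _ => by ring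

/-- The contracted Bianchi identity in the form
`V^a ∇^b (φ R_{ab}) = ½ φ V^a ∂_a R + V^a ⟨R_{a·}, dφ⟩`. -/
theorem contract_div₂_ricci (hg : IsMetricOn g s) {φ : Coord n → ℝ} (hφ : ContDiffOn ℝ ∞ φ s)
    (hR : ∀ z ∈ s, ∀ a b, ricci g z a b = ricci g z b a) (hy : y ∈ s) :
    ∑ a, V y a * div₂ g (fun z => φ z • Matrix.of (ricci g z)) y a =
      (1 / 2) * φ y * dirDeriv V (fun z => traceAt g z (ricci g z)) y
      + ∑ a, V y a * innerAt g y (ricci g y a) (grad φ y) := by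
  have h1 : ∀ a, div₂ g (fun z => ricci g z) y a =
      (1 / 2) * pd a (fun z => traceAt g z (ricci g z)) y := by
    intro a
    rw [hg.pd_scalarCurvature hy, ← mul_assoc]
    norm_num
    refine Finset.sum_congr rfl fun b _ => Finset.sum_congr rfl fun c _ => ?_
    rw [nabla₂_comm_of_symm hg.isOpen hR hy]
  have h2 : ∀ a, div₂ g (fun z => φ z • Matrix.of (ricci g z)) y a =
      φ y * div₂ g (fun z => ricci g z) y a + innerAt g y (ricci g y a) (grad φ y) :=
    fun a => div₂_smul hg.isOpen hφ hg.smooth_ricci hy a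
  simp only [h2, h1, mul_add, Finset.sum_add_distrib, dirDeriv, Finset.mul_sum]
  congr 1
  exact Finset.sum_congr rfl fun a _ => by ring

end Contraction

end IsMetricOn

/-! ### The identity in a chart -/

/-- The horizon equations with `X = Γ⁻¹ (K♭ - dΓ)` substituted, solved for `Γ T`. -/
theorem horizon_tensor_eq (hg : IsMetricOn g s) {k X : Coord n → Fin n → ℝ} {f : Coord n → ℝ}
    {T : Matrix (Fin n) (Fin n) ℝ} {l : ℝ} (hf : ContDiffOn ℝ ∞ f s) (hX : SmoothFormOn X s)
    (hf0 : ∀ z ∈ s, f z ≠ 0) (hk : ∀ z ∈ s, ∀ a, k z a = f z * X z a + grad f z a)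
    (hy : y ∈ s)
    (hric : ∀ a b, ricci g y a b = (1 / 2) * X y a * X y b - symNabla g X y a b + T a b
      - l * g y a b) :
    f y • T + ((2 * f y)⁻¹ • tensorMul k k y + Matrix.of (nabla₁ g (grad f) y)) =
      f y • Matrix.of (ricci g y) + ((2 * f y)⁻¹ • tensorMul (grad f) (grad f) y
        + (Matrix.of (symNabla g k y) + (f y * l) • g y)) := by
  have hu := smoothFormOn_grad hg.isOpen hf
  have hn : ∀ a b, nabla₁ g k y a b = f y * nabla₁ g X y a b + grad f y a * X y b
      + nabla₁ g (grad f) y a b := by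
    intro a b
    have hfX : DifferentiableAt ℝ (fun z => f z * X z b) y :=
      (diffAt hg.isOpen hf hy).mul (diffAt hg.isOpen (hX b) hy)
    have h1 : pd a (fun z => k z b) y
        = grad f y a * X y b + f y * pd a (fun z => X z b) y
          + pd a (fun z => grad f z b) y := by
      rw [pd_congr hg.isOpen (fun z hz => hk z hz b) hy,
        pd_add hfX (diffAt hg.isOpen (hu b) hy),
        pd_mul (diffAt hg.isOpen hf hy) (diffAt hg.isOpen (hX b) hy)]
      rfl
    simp only [nabla₁, h1, hk y hy, mul_add, Finset.sum_add_distrib,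
      mul_left_comm _ (f y), ← Finset.mul_sum]
    ring
  have hf0 := hf0 y hy
  ext a b
  simp only [Matrix.add_apply, Matrix.smul_apply, smul_eq_mul, tensorMul, Matrix.of_apply]
  rw [hric a b, symNabla, symNabla, hn a b, hn b a, hg.nabla₁_grad_comm hf hy b a, hk y hy a,
    hk y hy b]
  field_simp
  ring

/-- Data on an open subset of `ℝⁿ` satisfying the hypotheses of the divergence identity. Here `f`
is the function `Γ`, `V` holds the components of the vector field `K`, and `l` stands for the coefficient `(1/n) (g^{cd} T_{cd} + 2U)` of the metric in the horizon
equations. -/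
structure IsHorizonOn (g T : Coord n → Matrix (Fin n) (Fin n) ℝ) (U f l : Coord n → ℝ)
    (V X : Coord n → Fin n → ℝ) (s : Set (Coord n)) : Prop where
  metric : IsMetricOn g s
  smooth_T : SmoothEntriesOn T s
  symm_T : ∀ z ∈ s, ∀ a b, T z a b = T z b a
  smooth_U : ContDiffOn ℝ ∞ U s
  smooth_f : ContDiffOn ℝ ∞ f s
  f_ne_zero : ∀ z ∈ s, f z ≠ 0
  smooth_V : SmoothFormOn V s
  smooth_X : SmoothFormOn X s
  lower_V : ∀ z ∈ s, ∀ a, lower g V z a = f z * X z a + grad f z a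
  mul_l : ∀ z ∈ s, n * l z = traceAt g z (T z) + 2 * U z
  smooth_l : ContDiffOn ℝ ∞ l s
  ricci_eq : ∀ z ∈ s, ∀ a b, ricci g z a b = (1 / 2) * X z a * X z b - symNabla g X z a b
    + T z a b - l z * g z a b

namespace IsHorizonOn

variable {T : Coord n → Matrix (Fin n) (Fin n) ℝ} {U f l : Coord n → ℝ}
  {V X : Coord n → Fin n → ℝ}

theorem ricci_comm (h : IsHorizonOn g T U f l V X s) (hy : y ∈ s) (a b : Fin n) :
    ricci g y a b = ricci g y b a := by
  rw [h.ricci_eq y hy, h.ricci_eq y hy, h.symm_T y hy, h.metric.apply_comm hy a b]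
  simp only [symNabla]
  ring

theorem smooth_lower (h : IsHorizonOn g T U f l V X s) : SmoothFormOn (lower g V) s :=
  h.metric.smooth_lower h.smooth_V

theorem smooth_grad (h : IsHorizonOn g T U f l V X s) : SmoothFormOn (grad f) s :=
  smoothFormOn_grad h.metric.isOpen h.smooth_f

theorem smooth_inv_f (h : IsHorizonOn g T U f l V X s) :
    ContDiffOn ℝ ∞ (fun z => (2 * f z)⁻¹) s :=
  (contDiffOn_const.mul h.smooth_f).inv fun z hz => mul_ne_zero two_ne_zero (h.f_ne_zero z hz)

theorem smooth_laplacian (h : IsHorizonOn g T U f l V X s) : ContDiffOn ℝ ∞ (laplacian g f) s :=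
  h.metric.smooth_div₁ h.smooth_grad

theorem smooth_normSq (h : IsHorizonOn g T U f l V X s) :
    ContDiffOn ℝ ∞ (fun z => innerAt g z (lower g V z) (lower g V z)) s :=
  h.metric.smooth_innerAt h.smooth_lower h.smooth_lower

/-- The gradient of `(2Γ)⁻¹` is `-2 (2Γ)⁻² ∇Γ`. -/
theorem grad_inv_f (h : IsHorizonOn g T U f l V X s) (hy : y ∈ s) (a : Fin n) :
    pd a (fun z => (2 * f z)⁻¹) y = -2 * (2 * f y)⁻¹ ^ 2 * pd a f y := by
  have h0 := h.f_ne_zero y hy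
  have hd := diffAt h.metric.isOpen h.smooth_inv_f hy
  have hf := diffAt h.metric.isOpen h.smooth_f hy
  have h1 : pd a (fun z => (2 * f z)⁻¹ * f z) y = 0 := by
    rw [pd_congr h.metric.isOpen (h := fun _ => 1 / 2) (fun z hz => by
      have := h.f_ne_zero z hz
      field_simp) hy, pd_const]
  rw [pd_mul hd hf] at h1
  field_simp at h1 ⊢
  linarith

/-- The trace of the horizon equations. -/
theorem mul_scalarCurvature (h : IsHorizonOn g T U f l V X s) (hy : y ∈ s) :
    f y * traceAt g y (ricci g y) =
      (2 * f y)⁻¹ * innerAt g y (lower g V y) (lower g V y)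
      - (2 * f y)⁻¹ * innerAt g y (grad f y) (grad f y)
      - div₁ g (lower g V) y + laplacian g f y - 2 * (f y * U y) := by
  have h1 := congrArg (traceAt g y) (horizon_tensor_eq h.metric h.smooth_f h.smooth_X
    h.f_ne_zero h.lower_V hy (h.ricci_eq y hy))
  simp only [traceAt_add, traceAt_smul, traceAt_tensorMul, h.metric.traceAt_metric hy] at h1
  have h2 : traceAt g y (Matrix.of (symNabla g (lower g V) y)) = div₁ g (lower g V) y :=
    h.metric.traceAt_symNabla hy _
  have h3 : traceAt g y (Matrix.of (nabla₁ g (grad f) y)) = laplacian g f y := rfl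
  have h4 : traceAt g y (Matrix.of (ricci g y)) = traceAt g y (ricci g y) := rfl
  rw [h2, h3, h4] at h1
  have h5 := h.mul_l y hy
  linear_combination -h1 - f y * h5

/-- `V^a ∇^b (Γ T_{ab})`, computed from the horizon equations, the contracted Bianchi identity
and the commutation rule for third derivatives of `Γ`; the two curvature terms cancel. -/
theorem contract_div₂_T (h : IsHorizonOn g T U f l V X s) (hy : y ∈ s) :
    ∑ a, V y a * div₂ g (fun z => f z • T z) y a =
      -(1 / 2) * dirDeriv V (div₁ g (lower g V)) y - (1 / 2) * dirDeriv V (laplacian g f) y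
      - dirDeriv V (fun z => f z * U z) y + U y * dirDeriv V f y
      + dirDeriv V (fun z => f z * l z) y
      + ∑ a, V y a * div₂ g (fun z => symNabla g (lower g V) z) y a
      + (2 * f y)⁻¹ * (dirDeriv V f y - innerAt g y (lower g V y) (lower g V y))
        * div₁ g (lower g V) y := by
  have hs := h.metric.isOpen
  have hk := h.smooth_lower
  have hu := h.smooth_grad
  have hq := h.smooth_inv_f
  have hf := h.smooth_f
  have hkk := hk.tensorMul hk
  have huu := hu.tensorMul hu
  have hH : SmoothEntriesOn (fun z => Matrix.of (nabla₁ g (grad f) z)) s :=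
    h.metric.smooth_nabla₁ hu
  have hS : SmoothEntriesOn (fun z => Matrix.of (symNabla g (lower g V) z)) s :=
    h.metric.smooth_symNabla hk
  have hRic : SmoothEntriesOn (fun z => Matrix.of (ricci g z)) s := h.metric.smooth_ricci
  have hfl := hf.mul h.smooth_l
  have hgfl : SmoothEntriesOn (fun z => (f z * l z) • g z) s := h.metric.smooth.smul hfl
  -- the divergence of the tensor equation, contracted with `V`
  have hdiv : ∀ a, div₂ g (fun z => f z • T z) y a
      + (div₂ g (fun z => (2 * f z)⁻¹ • tensorMul (lower g V) (lower g V) z) y a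
        + div₂ g (fun z => Matrix.of (nabla₁ g (grad f) z)) y a)
      = div₂ g (fun z => f z • Matrix.of (ricci g z)) y a
        + (div₂ g (fun z => (2 * f z)⁻¹ • tensorMul (grad f) (grad f) z) y a
        + (div₂ g (fun z => Matrix.of (symNabla g (lower g V) z)) y a
          + pd a (fun z => f z * l z) y)) := by
    intro a
    have := div₂_congr (g := g) hs (fun z hz => horizon_tensor_eq h.metric h.smooth_f h.smooth_X
      h.f_ne_zero h.lower_V hz (h.ricci_eq z hz)) hy a
    rw [div₂_add hs (h.smooth_T.smul hf) ((hkk.smul hq).add hH) hy,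
      div₂_add hs (hkk.smul hq) hH hy,
      div₂_add hs (hRic.smul hf) ((huu.smul hq).add (hS.add hgfl)) hy,
      div₂_add hs (huu.smul hq) (hS.add hgfl) hy, div₂_add hs hS hgfl hy] at this
    rw [this]
    congr 3
    exact h.metric.div₂_smul_metric hfl hy a
  have hsum := Finset.sum_congr (rfl : (Finset.univ : Finset (Fin n)) = Finset.univ)
    fun a _ => congrArg (V y a * ·) (hdiv a)
  simp only [mul_add, Finset.sum_add_distrib] at hsum
  have hhess : ∑ a, V y a * div₂ g (fun z => Matrix.of (nabla₁ g (grad f) z)) y a =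
      dirDeriv V (laplacian g f) y + ∑ a, V y a * innerAt g y (ricci g y a) (grad f y) := by
    rw [dirDeriv, ← Finset.sum_add_distrib]
    refine Finset.sum_congr rfl fun a _ => ?_
    have h1 : ricci g y a = fun b => ricci g y b a := funext fun b => h.ricci_comm hy a b
    rw [← mul_add, h1]
    exact congrArg _ (h.metric.div₂_hessian hf hy a)
  have hS' : ∑ a, V y a * div₂ g (fun z => Matrix.of (symNabla g (lower g V) z)) y a
      = ∑ a, V y a * div₂ g (fun z => symNabla g (lower g V) z) y a := rfl
  have hl' : ∑ a, V y a * pd a (fun z => f z * l z) y = dirDeriv V (fun z => f z * l z) y := rfl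
  rw [h.metric.contract_div₂_lower h.smooth_V hq hy, hhess,
    h.metric.contract_div₂_ricci hf (fun z hz => h.ricci_comm hz) hy,
    h.metric.contract_div₂_grad hf hq hy, hS', hl'] at hsum
  -- the derivative of the trace equation along `V`
  have hkk' := h.smooth_normSq
  have huu' := h.metric.smooth_innerAt hu hu
  have htr := dirDeriv_congr (V := V) hs (φ := fun z => f z * traceAt g z (ricci g z)
      + (2 * f z)⁻¹ * innerAt g z (grad f z) (grad f z) + div₁ g (lower g V) z
      + 2 * (f z * U z))
    (ψ := fun z => (2 * f z)⁻¹ * innerAt g z (lower g V z) (lower g V z) + laplacian g f z)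
    (fun z hz => by rw [h.mul_scalarCurvature hz]; ring) hy
  have hR := h.metric.smooth_traceAt h.metric.smooth_ricci
  have hfU := hf.mul h.smooth_U
  have e1 := hf.mul hR
  have e2 := hq.mul huu'
  have hdk := h.metric.smooth_div₁ hk
  rw [dirDeriv_add hs ((e1.add e2).add hdk) (contDiffOn_const.mul hfU) hy,
    dirDeriv_add hs (e1.add e2) hdk hy, dirDeriv_add hs e1 e2 hy,
    dirDeriv_add hs (hq.mul hkk') h.smooth_laplacian hy, dirDeriv_mul hs hf hR hy,
    dirDeriv_mul hs hq huu' hy, dirDeriv_mul hs hq hkk' hy,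
    dirDeriv_const_mul hs 2 hfU hy] at htr
  have hDq : dirDeriv V (fun z => (2 * f z)⁻¹) y
      = -2 * (2 * f y)⁻¹ ^ 2 * dirDeriv V f y := by
    simp only [dirDeriv, h.grad_inv_f hy, Finset.mul_sum]
    exact Finset.sum_congr rfl fun a _ => by ring
  have hgq : innerAt g y (grad f y) (grad (fun z => (2 * f z)⁻¹) y)
      = -2 * (2 * f y)⁻¹ ^ 2 * innerAt g y (grad f y) (grad f y) := by
    rw [h.metric.innerAt_comm hy, ← innerAt_mul_left]
    congr 1
    exact funext fun a => h.grad_inv_f hy a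
  have htr0 := h.mul_scalarCurvature hy
  rw [hDq] at htr hsum
  rw [hgq] at hsum
  -- `q Γ = ½` is the only relation between `q` and `Γ` that the cancellations need
  have hqf : (2 * f y)⁻¹ * (2 * f y) = 1 :=
    inv_mul_cancel₀ (mul_ne_zero two_ne_zero (h.f_ne_zero y hy))
  set q := (2 * f y)⁻¹
  set R := traceAt g y (ricci g y)
  linear_combination hsum + (1 / 2) * htr - q * dirDeriv V f y * htr0
    + (1 / 2) * dirDeriv V f y * R * hqf
    + dirDeriv V f y * U y * hqf

theorem smooth_betaForm (h : IsHorizonOn g T U f l V X s) :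
    SmoothFormOn (betaForm g V f T U) s := fun a =>
  (h.smooth_f.inv h.f_ne_zero).mul
    ((((h.metric.smooth_div₂ (h.smooth_T.smul h.smooth_f) a).neg.add
      (ContDiffOn.sum fun b _ => (h.smooth_V b).mul (h.smooth_T a b))).sub
      (h.smooth_U.mul (h.smooth_lower a))).add (h.smooth_U.mul (h.smooth_grad a)))

theorem aFun_eq (h : IsHorizonOn g T U f l V X s) (hn : n ≠ 0) (hy : y ∈ s) :
    aFun g V f T U y = -(2 * f y)⁻¹ * innerAt g y (lower g V y) (lower g V y)
      + (1 / 2) * laplacian g f y - (1 / 2) * div₁ g (lower g V) y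
      - (2 * f y)⁻¹ * dirDeriv V f y + f y * U y - f y * l y := by
  have hn' : (n : ℝ) ≠ 0 := Nat.cast_ne_zero.2 hn
  have hl : l y = (traceAt g y (T y) + 2 * U y) / n := by
    rw [← h.mul_l y hy]
    field_simp
  have hD : ∑ b, V y b * grad f y b = dirDeriv V f y := rfl
  rw [aFun, hD, hl]
  ring

/-- In the current `J`, the terms proportional to `K` combine to
`-(½ ΔΓ + ½ ∇_b K^b + Γ U - Γ l) K_a`: the terms with `1/Γ` drop out. -/
theorem currentForm_eq (h : IsHorizonOn g T U f l V X s) (hn : n ≠ 0) (hy : y ∈ s) (a : Fin n) :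
    currentForm g V f T U y a = ∑ b, V y b * symNabla g (lower g V) y b a
      + ((-(1 / 2) * (laplacian g f y + div₁ g (lower g V) y) + (f y * l y + -1 * (f y * U y)))
        * lower g V y a + -(1 / 2) * (f y ^ 2 * betaForm g V f T U y a)) := by
  have hD : ∑ b, V y b * grad f y b = dirDeriv V f y := rfl
  have hS : ∑ b, V y b * symNabla g (lower g V) y a b
      = ∑ b, V y b * symNabla g (lower g V) y b a :=
    Finset.sum_congr rfl fun b _ => by simp only [symNabla, add_comm]
  rw [currentForm, hD, hS, h.aFun_eq hn hy]
  ring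

/-- `Γ K^a β_a`, with the definition of `β` inserted. -/
theorem mul_contract_betaForm (h : IsHorizonOn g T U f l V X s) (hy : y ∈ s) :
    f y * ∑ a, V y a * betaForm g V f T U y a =
      -∑ a, V y a * div₂ g (fun z => f z • T z) y a + ∑ a, ∑ b, T y a b * V y a * V y b
      - U y * innerAt g y (lower g V y) (lower g V y) + U y * dirDeriv V f y := by
  have h0 := h.f_ne_zero y hy
  rw [h.metric.innerAt_lower hy]
  simp only [dirDeriv, Finset.mul_sum, ← Finset.sum_neg_distrib, ← Finset.sum_add_distrib,
    ← Finset.sum_sub_distrib]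
  refine Finset.sum_congr rfl fun a _ => ?_
  have h1 : ∑ b, T y a b * V y a * V y b = V y a * ∑ b, V y b * T y a b := by
    rw [Finset.mul_sum]
    exact Finset.sum_congr rfl fun b _ => by ring
  rw [h1, betaForm, grad]
  field_simp

/-- The divergence identity in a chart. -/
theorem divergence_identity (h : IsHorizonOn g T U f l V X s) (hn : n ≠ 0) (hy : y ∈ s) :
    (1 / 4) * normSqAt g y (lieMetric g V y) + gammaFun g V f T U y =
      div₁ g (currentForm g V f T U) y + div₁ g (lower g V) y *
        (aFun g V f T U y + div₁ g (lower g V) y + 1 / f y * ∑ a, V y a * grad f y a) := by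
  have hs := h.metric.isOpen
  have hf0 := h.f_ne_zero y hy
  have hk := h.smooth_lower
  have hβ := h.smooth_betaForm
  have hdk := h.metric.smooth_div₁ hk
  have hL := h.smooth_laplacian
  have hfl := h.smooth_f.mul h.smooth_l
  have hfU := h.smooth_f.mul h.smooth_U
  have hS := h.metric.smooth_symNabla hk
  have hLie : normSqAt g y (lieMetric g V y) = 4 * normSqAt g y (symNabla g (lower g V) y) := by
    rw [← normSqAt_two_mul]
    congr 1
    funext a b
    exact h.metric.lieMetric_eq h.smooth_V hy a b
  have hc1 : ContDiffOn ℝ ∞ (fun z => -(1 / 2) * (laplacian g f z + div₁ g (lower g V) z)) s :=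
    contDiffOn_const.mul (hL.add hdk)
  have hc2 : ContDiffOn ℝ ∞ (fun z => -1 * (f z * U z)) s := contDiffOn_const.mul hfU
  have hψ := hc1.add (hfl.add hc2)
  have hβ' : SmoothFormOn (fun z a => f z ^ 2 * betaForm g V f T U z a) s :=
    fun a => (h.smooth_f.pow 2).mul (hβ a)
  have hθ₁ : SmoothFormOn (fun z a => ∑ b, V z b * symNabla g (lower g V) z b a) s :=
    fun a => ContDiffOn.sum fun b _ => (h.smooth_V b).mul (hS b a)
  have hθ₂ : SmoothFormOn (fun z a => (-(1 / 2) * (laplacian g f z + div₁ g (lower g V) z)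
      + (f z * l z + -1 * (f z * U z))) * lower g V z a) s := fun a => hψ.mul (hk a)
  have hθ₃ : SmoothFormOn (fun z a => -(1 / 2) * (f z ^ 2 * betaForm g V f T U z a)) s :=
    fun a => contDiffOn_const.mul (hβ' a)
  have hconst : innerAt g y (grad (fun _ => -(1 / 2)) y)
      (fun a => f y ^ 2 * betaForm g V f T U y a) = 0 := by
    simp [innerAt, grad, pd_const]
  have hJ : div₁ g (currentForm g V f T U) y = _ :=
    div₁_congr hs (fun z hz => funext fun a => h.currentForm_eq hn hz a) hy
  rw [div₁_add hs hθ₁ (fun a => (hθ₂ a).add (hθ₃ a)) hy, div₁_add hs hθ₂ hθ₃ hy,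
    h.metric.div₁_contract h.smooth_V hS hy, sum_nabla₁_symNabla,
    div₁_mul hs hψ hk hy, div₁_mul hs contDiffOn_const hβ' hy, hconst,
    h.metric.innerAt_grad_lower hy, dirDeriv_add hs hc1 (hfl.add hc2) hy,
    dirDeriv_add hs hfl hc2 hy, dirDeriv_const_mul hs _ (hL.add hdk) hy,
    dirDeriv_const_mul hs _ hfU hy, dirDeriv_add hs hL hdk hy] at hJ
  have hα : f y ^ 2 * alphaFun g V f T U y = f y * ∑ a, V y a * betaForm g V f T U y a
      - (1 / 2) * div₁ g (fun z a => f z ^ 2 * betaForm g V f T U z a) y := by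
    rw [alphaFun, ← mul_assoc, mul_inv_cancel₀ (pow_ne_zero 2 hf0), one_mul]
  have hD : ∑ b, V y b * grad f y b = dirDeriv V f y := rfl
  have hinv : 1 / f y = 2 * (2 * f y)⁻¹ := by field_simp
  rw [hLie, gammaFun, hα, hJ, hD, h.aFun_eq hn hy, hinv]
  linear_combination h.contract_div₂_T hy - h.mul_contract_betaForm hy

end IsHorizonOn

end Coordinates

/-! ### Coordinate components on a manifold -/

section Manifold

variable {n : ℕ} {M : Type*} [TopologicalSpace M] [ChartedSpace (Coord n) M]
  {e : OpenPartialHomeomorph M (Coord n)} {y : Coord n}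

/-- The coordinate vector fields span the image of the derivative of the inverse chart. -/
theorem mfderiv_symm_eq_sum (e : OpenPartialHomeomorph M (Coord n)) (y u : Coord n) :
    mfderiv (𝓡 n) (𝓡 n) e.symm y u = ∑ a, u a • coordVec e y a := by
  have hu : u = ∑ a, u a • (EuclideanSpace.single a (1 : ℝ) : Coord n) := by
    ext i
    simp [Pi.single_apply]
  have h := congrArg (fun v : Coord n => (mfderiv (𝓡 n) (𝓡 n) e.symm y v : _)) hu
  refine h.trans ?_
  exact (map_sum (mfderiv (𝓡 n) (𝓡 n) e.symm y) _ _).trans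
    (Finset.sum_congr rfl fun a _ => map_smul (mfderiv (𝓡 n) (𝓡 n) e.symm y) _ _)

theorem mdifferentiable_of_mem_maximalAtlas (he : e ∈ IsManifold.maximalAtlas (𝓡 n) ∞ M) :
    e.MDifferentiable (𝓡 n) (𝓡 n) :=
  ⟨(contMDiffOn_of_mem_maximalAtlas he).mdifferentiableOn (by simp),
    (contMDiffOn_symm_of_mem_maximalAtlas he).mdifferentiableOn (by simp)⟩

theorem contDiffOn_funIn (he : e ∈ IsManifold.maximalAtlas (𝓡 n) ∞ M) {f : M → ℝ}
    (hf : ContMDiff (𝓡 n) 𝓘(ℝ, ℝ) ∞ f) : ContDiffOn ℝ ∞ (funIn e f) e.target :=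
  (hf.comp_contMDiffOn (contMDiffOn_symm_of_mem_maximalAtlas he)).contDiffOn

/-- `(df)_a = ∂_a f`. -/
theorem formIn_dForm (he : e ∈ IsManifold.maximalAtlas (𝓡 n) ∞ M) {f : M → ℝ}
    (hf : ContMDiff (𝓡 n) 𝓘(ℝ, ℝ) ∞ f) (hy : y ∈ e.target) (a : Fin n) :
    dForm f (e.symm y) (coordVec e y a) = grad (funIn e f) y a := by
  have h := mfderiv_comp y (hf.mdifferentiableAt (x := e.symm y) (by simp))
    ((mdifferentiable_of_mem_maximalAtlas he).mdifferentiableAt_symm hy)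
  rw [mfderiv_eq_fderiv] at h
  exact (congrArg (fun L : Coord n →L[ℝ] ℝ => L (EuclideanSpace.single a 1)) h).symm

/-- `V = V^a ∂_a`. -/
theorem sum_vecIn_smul_coordVec (he : e ∈ IsManifold.maximalAtlas (𝓡 n) ∞ M)
    (V : ∀ p : M, TangentSpace (𝓡 n) p) (hy : y ∈ e.target) :
    ∑ a, vecIn e V y a • coordVec e y a = V (e.symm y) := by
  have h := (mdifferentiable_of_mem_maximalAtlas he).symm_comp_deriv (e.map_target hy)
  have h2 := congrArg (fun L => L (V (e.symm y))) h
  rw [e.right_inv hy] at h2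
  rw [← show _ = V (e.symm y) from h2]
  exact (mfderiv_symm_eq_sum e y _).symm

section Smooth

variable [IsManifold (𝓡 n) ∞ M]

theorem contMDiffOn_coordVec (he : e ∈ IsManifold.maximalAtlas (𝓡 n) ∞ M) (a : Fin n) :
    ContMDiffOn (𝓡 n) ((𝓡 n).prod (𝓡 n)) ∞
      (fun z => TotalSpace.mk' (Coord n) (E := fun p : M => TangentSpace (𝓡 n) p)
        (e.symm z) (coordVec e z a)) e.target := by
  have : IsManifold (𝓡 n) 1 M := IsManifold.of_le (n := ∞) (by simp)
  have h1 := (contMDiffOn_symm_of_mem_maximalAtlas he).contMDiffOn_tangentMapWithin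
    (m := ∞) (by simp) e.open_target.uniqueMDiffOn
  have h2 : ContMDiffOn (𝓡 n) ((𝓡 n).prod (𝓡 n)) ∞
      (fun z => TotalSpace.mk' (Coord n) (E := fun p : Coord n => TangentSpace (𝓡 n) p)
        z (EuclideanSpace.single a (1 : ℝ) : Coord n)) e.target :=
    contMDiffOn_vectorSpace_iff_contDiffOn.2 contDiffOn_const
  refine (h1.comp h2 fun z hz => hz).congr fun z hz => ?_
  simp only [Function.comp, tangentMapWithin, coordVec,
    mfderivWithin_of_isOpen e.open_target hz]

theorem smoothFormOn_formIn (he : e ∈ IsManifold.maximalAtlas (𝓡 n) ∞ M)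
    {θ : ∀ p : M, TangentSpace (𝓡 n) p →L[ℝ] ℝ}
    (hθ : ContMDiff (𝓡 n) ((𝓡 n).prod 𝓘(ℝ, Coord n →L[ℝ] ℝ)) ∞
      (fun p => TotalSpace.mk' (Coord n →L[ℝ] ℝ)
        (E := fun p : M => TangentSpace (𝓡 n) p →L[ℝ] Trivial M ℝ p) p (θ p))) :
    SmoothFormOn (formIn e θ) e.target := by
  intro a
  have h1 := hθ.comp_contMDiffOn (contMDiffOn_symm_of_mem_maximalAtlas he)
  have h2 : ContMDiffOn (𝓡 n) ((𝓡 n).prod 𝓘(ℝ, ℝ)) ∞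
      (fun z => TotalSpace.mk' ℝ (E := Trivial M ℝ) (e.symm z)
        (θ (e.symm z) (coordVec e z a))) e.target :=
    ContMDiffOn.clm_bundle_apply (F₁ := Coord n) h1 (contMDiffOn_coordVec he a)
  intro z hz
  have h3 := (contMDiffWithinAt_totalSpace.1 (h2 z hz)).2
  exact h3.contDiffWithinAt

theorem smoothEntriesOn_tensorIn (he : e ∈ IsManifold.maximalAtlas (𝓡 n) ∞ M)
    {S : ∀ p : M, TangentSpace (𝓡 n) p →L[ℝ] TangentSpace (𝓡 n) p →L[ℝ] ℝ}
    (hS : ContMDiff (𝓡 n) ((𝓡 n).prod 𝓘(ℝ, Coord n →L[ℝ] Coord n →L[ℝ] ℝ)) ∞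
      (fun p => TotalSpace.mk' (Coord n →L[ℝ] Coord n →L[ℝ] ℝ)
        (E := fun p : M => TangentSpace (𝓡 n) p →L[ℝ] TangentSpace (𝓡 n) p →L[ℝ] Trivial M ℝ p)
        p (S p))) :
    SmoothEntriesOn (tensorIn e S) e.target := by
  intro a b
  have h1 := hS.comp_contMDiffOn (contMDiffOn_symm_of_mem_maximalAtlas he)
  have h2 : ContMDiffOn (𝓡 n) ((𝓡 n).prod 𝓘(ℝ, ℝ)) ∞
      (fun z => TotalSpace.mk' ℝ (E := Trivial M ℝ) (e.symm z)
        (S (e.symm z) (coordVec e z a) (coordVec e z b))) e.target :=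
    ContMDiffOn.clm_bundle_apply₂ (F₁ := Coord n) (F₂ := Coord n) h1
      (contMDiffOn_coordVec he a) (contMDiffOn_coordVec he b)
  intro z hz
  have h3 := (contMDiffWithinAt_totalSpace.1 (h2 z hz)).2
  exact h3.contDiffWithinAt

/-- The components of a Riemannian metric form a metric on the image of the chart. -/
theorem isMetricOn_tensorIn (he : e ∈ IsManifold.maximalAtlas (𝓡 n) ∞ M)
    (g : ContMDiffRiemannianMetric (𝓡 n) ∞ (Coord n) (fun p : M => TangentSpace (𝓡 n) p)) :
    IsMetricOn (tensorIn e g.inner) e.target where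
  isOpen := e.open_target
  smooth := smoothEntriesOn_tensorIn he g.contMDiff
  symm z _ := by
    ext a b
    exact g.symm _ _ _
  isUnit z hz := by
    rw [isUnit_iff_ne_zero]
    intro hdet
    -- a null vector `v` of the Gram matrix gives a tangent vector `w = v^a ∂_a` with `g(w, w) = 0`
    obtain ⟨v, hv0, hv⟩ := Matrix.exists_mulVec_eq_zero_iff.2 hdet
    obtain ⟨w, hw⟩ : ∃ w : TangentSpace (𝓡 n) (e.symm z), w = ∑ a, v a • coordVec e z a :=
      ⟨_, rfl⟩
    have h1 : ∀ a, g.inner (e.symm z) w (coordVec e z a) = 0 := by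
      intro a
      have := congrFun hv a
      simp only [Matrix.mulVec, dotProduct, tensorIn, Matrix.of_apply, Pi.zero_apply] at this
      rw [g.symm, hw, map_sum, ← this]
      exact Finset.sum_congr rfl fun b _ => by rw [map_smul, smul_eq_mul, mul_comm]
    have hww : g.inner (e.symm z) w w = 0 := by
      rw [show g.inner (e.symm z) w w = g.inner (e.symm z) w (∑ a, v a • coordVec e z a) from
        congrArg _ hw, map_sum]
      exact Finset.sum_eq_zero fun a _ => by rw [map_smul, h1, smul_zero]
    have hw0 : w = 0 := by
      by_contra h
      exact (g.pos _ w h).ne' hww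
    have h2 := congrArg (fun L => L (WithLp.toLp 2 v : Coord n))
      ((mdifferentiable_of_mem_maximalAtlas he).comp_symm_deriv hz)
    have h3 : mfderiv (𝓡 n) (𝓡 n) e.symm z (WithLp.toLp 2 v : Coord n) = 0 :=
      (mfderiv_symm_eq_sum e z _).trans (hw.symm.trans hw0)
    have h4 : (WithLp.toLp 2 v : Coord n) = 0 := by
      refine h2.symm.trans ?_
      exact (congrArg (mfderiv (𝓡 n) (𝓡 n) e (e.symm z)) h3).trans (map_zero _)
    apply hv0
    ext i
    exact congrArg (fun u : Coord n => u i) h4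

end Smooth

end Manifold

end ExtremalHorizon

open ExtremalHorizon
theorem proposition3p1 {n : ℕ} (hn : 1 ≤ n) {M : Type*} [TopologicalSpace M]
    [ChartedSpace (Coord n) M] [IsManifold (𝓡 n) ∞ M]
    (D : HorizonData n M) (hD : D.SolvesHorizonEquations)
    (Γ : M → ℝ) (hΓ : ContMDiff (𝓡 n) 𝓘(ℝ, ℝ) ∞ Γ) (hΓpos : ∀ p, 0 < Γ p)
    (K : ∀ p : M, TangentSpace (𝓡 n) p)
    (hK : ∀ (p : M) (v : TangentSpace (𝓡 n) p),
      D.g.inner p (K p) v = Γ p * D.X p v + dForm Γ p v)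
    (e : OpenPartialHomeomorph M (Coord n)) (he : e ∈ IsManifold.maximalAtlas (𝓡 n) ∞ M)
    (g T : Coord n → Matrix (Fin n) (Fin n) ℝ) (U f : Coord n → ℝ) (V : Coord n → Fin n → ℝ)
    (hg : g = tensorIn e D.g.inner) (hT : T = tensorIn e D.T) (hU : U = funIn e D.U)
    (hf : f = funIn e Γ) (hV : V = vecIn e K) :
    ∀ y ∈ e.target,
      (1 / 4) * normSqAt g y (lieMetric g V y) + gammaFun g V f T U y =
        div₁ g (currentForm g V f T U) y
          + div₁ g (lower g V) y *
            (aFun g V f T U y + div₁ g (lower g V) y + 1 / f y * ∑ a, V y a * grad f y a) := by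
  intro y hy
  have hn0 : n ≠ 0 := Nat.one_le_iff_ne_zero.1 hn
  have hmet : IsMetricOn g e.target := hg ▸ isMetricOn_tensorIn he D.g
  have hTs : SmoothEntriesOn T e.target := hT ▸ smoothEntriesOn_tensorIn he D.smooth_T
  have hUs : ContDiffOn ℝ ∞ U e.target := hU ▸ contDiffOn_funIn he D.smooth_U
  have hfs : ContDiffOn ℝ ∞ f e.target := hf ▸ contDiffOn_funIn he hΓ
  have hXs : SmoothFormOn (formIn e D.X) e.target := smoothFormOn_formIn he D.smooth_X
  have hlow : ∀ z ∈ e.target, ∀ a, lower g V z a = f z * formIn e D.X z a + grad f z a := by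
    intro z hz a
    have h1 := hK (e.symm z) (coordVec e z a)
    rw [formIn_dForm he hΓ hz a, D.g.symm, ← sum_vecIn_smul_coordVec he K hz, map_sum] at h1
    rw [hf]
    refine Eq.trans ?_ h1
    rw [hg, hV]
    exact Finset.sum_congr rfl fun b _ => by
      rw [map_smul, smul_eq_mul, mul_comm]
      rfl
  have hVs : SmoothFormOn V e.target := fun a =>
    (ContDiffOn.sum fun b _ => (hmet.smooth_inv a b).mul
      ((hfs.mul (hXs b)).add (contDiffOn_pd hmet.isOpen hfs b))).congr fun z hz => by
        rw [← hmet.sum_inv_mul_lower hz V a]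
        exact Finset.sum_congr rfl fun b _ => congrArg _ (hlow z hz b)
  have h : IsHorizonOn g T U f (fun z => 1 / (n : ℝ) * (traceAt g z (T z) + 2 * U z)) V
      (formIn e D.X) e.target :=
    { metric := hmet
      smooth_T := hTs
      symm_T := fun z _ a b => by subst hT; exact D.symm_T _ _ _
      smooth_U := hUs
      smooth_f := hfs
      f_ne_zero := fun z _ => by subst hf; exact (hΓpos _).ne'
      smooth_V := hVs
      smooth_X := hXs
      lower_V := hlow
      mul_l := fun z _ => by
        have : (n : ℝ) ≠ 0 := Nat.cast_ne_zero.2 hn0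
        field_simp
      smooth_l := contDiffOn_const.mul ((hmet.smooth_traceAt hTs).add (contDiffOn_const.mul hUs))
      ricci_eq := fun z hz a b => by subst hg hT hU; exact hD e he z hz a b }
  exact h.divergence_identity hn0 hy
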